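/- **Setting.** For a partition $\lambda=(\lambda_1\ge\lambda_2\ge\cdots)$ let $m_\lambda$ and $p_\lambda$ be the monomial and power sum symmetric functions, $\ell(\lambda)$ the number of parts, $m_i(\lambda)$ the number of parts equal to $i$ and $z_\lambda=\prod_i i^{m_i(\lambda)}m_i(\lambda)!$. For an indeterminate $b$, the Jack symmetric functions $P_\lambda^{(b)}\in\Lambda_{\mathbb Q(b)}$ are the symmetric functions determined by: (i) $P_\lambda^{(b)}-m_\lambda$ is a $\mathbb Q(b)$-linear combination of the $m_\mu$ with $\mu<\lambda$ in the dominance order; (ii) $\langle P_\lambda^{(b)},P_\mu^{(b)}\rangle_b=0$ for $\lambda\ne\mu$, where $\langle p_\lambda,p_\mu\rangle_b=\delta_{\lambda,\mu}z_\lambda b^{\ell(\lambda)}$. Let $\alpha\in\mathbb C$ and let $\mathcal F_\alpha$ be the Fock space of the Heisenberg algebra $[a_m,a_n]=m\delta_{m+n,0}$, generated by a vector $|\alpha\rangle$ with $a_n|\alpha\rangle=0$ for $n\ge 1$ and $a_0|\alpha\rangle=\alpha|\alpha\rangle$, with basis $a_{-\lambda}|\alpha\rangle=a_{-\lambda_\ell}\cdots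 a_{-\lambda_1}|\alpha\rangle$. Let $\beta$ be a nonzero complex number, $\beta^{1/2}$ either square root of $\beta$, and put $\beta^{-1/2}=1/\beta^{1/2}$, $\sqrt{2\beta}=\sqrt2\,\beta^{1/2}$, $\sqrt{\beta/2}=\beta^{1/2}/\sqrt2$ and $\rho=(\beta^{1/2}-\beta^{-1/2})/\sqrt2$. Let $\iota_\beta:\mathcal F_\alpha\to\Lambda_{\mathbb C}$ be the linear isomorphism $a_{-\lambda}|\alpha\rangle\mapsto(\sqrt{\beta/2})^{\ell(\lambda)}p_\lambda$, and define the operators on $\mathcal F_\alpha$ $$L_n=\tfrac12\sum_{m\in\mathbb Z}{:}a_ma_{n-m}{:}-(n+1)\rho\,a_n,\qquad \widehat E_\beta=\sqrt{2\beta}\sum_{n>0}a_{-n}L_n+\sum_{n>0}a_{-n}a_n\bigl(\beta-1-\sqrt{2\beta}\,a_0\bigr),$$ where ${:}\ {:}$ is the normal ordering (the sums are finite on each vector). **Proposition.** Let $\lambda$ be any partition, and let $\beta\neq0$ be generic in the sense that none of the coefficients in $\mathbb Q(b)$ of the expansion of $P_\lambda^{(b)}$ in monomial symmetric functions has a pole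 at $b=\beta^{-1}$ (for each $\lambda$ this excludes only finitely many $\beta$). Let $P_\lambda^{(\beta^{-1})}\in\Lambda_{\mathbb C}$ be the specialization at $b=\beta^{-1}$ and let $f_\lambda\in\mathcal F_\alpha$ be the vector with $\iota_\beta(f_\lambda)=P_\lambda^{(\beta^{-1})}$. Then $$\widehat E_\beta f_\lambda=\varepsilon_\lambda(\beta)f_\lambda,\qquad \varepsilon_\lambda(\beta)=\sum_i\bigl(\lambda_i^2+\beta(1-2i)\lambda_i\bigr).$$ -/

import Mathlib

namespace SymFn

open MvPowerSeries

/-- The multiset of nonzero exponents of a monomial `x^e`. -/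
def expType (e : ℕ →₀ ℕ) : Multiset ℕ := e.support.val.map e

theorem card_expType (e : ℕ →₀ ℕ) : (expType e).card = e.support.card := by
  simp [expType]

theorem expType_pos {e : ℕ →₀ ℕ} {a : ℕ} (h : a ∈ expType e) : 0 < a := by
  simp only [expType, Multiset.mem_map] at h
  obtain ⟨i, hi, rfl⟩ := h
  exact Nat.pos_of_ne_zero (Finsupp.mem_support_iff.1 hi)

theorem sum_expType (e : ℕ →₀ ℕ) : (expType e).sum = e.degree := rfl

theorem expType_embDomain (σ : ℕ ↪ ℕ) (e : ℕ →₀ ℕ) : expType (e.embDomain σ) = expType e := by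
  simp [expType, Finsupp.support_embDomain]

theorem expType_add_single {e : ℕ →₀ ℕ} {i a : ℕ} (hi : e i = 0) (ha : a ≠ 0) :
    expType (Finsupp.single i a + e) = a ::ₘ expType e := by
  have hd : Disjoint (Finsupp.single i a).support e.support := by
    rw [Finsupp.support_single _ ha]; simpa using hi
  have hs : (Finsupp.single i a + e).support = Finset.cons i e.support (by simpa using hi) := by
    rw [Finsupp.support_add_eq hd, Finsupp.support_single _ ha]; ext; simp
  rw [expType, hs, Finset.cons_val, Multiset.map_cons]
  congr 1
  · simp [hi]
  · refine Multiset.map_congr rfl fun j hj => ?_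
    have : i ≠ j := by
      rintro rfl; exact (Finsupp.mem_support_iff.1 hj) hi
    simp [this]

theorem exists_expType (s : Multiset ℕ) (hs : ∀ a ∈ s, 0 < a) : ∃ e, expType e = s := by
  induction s using Multiset.induction_on with
  | empty => exact ⟨0, by simp [expType]⟩
  | cons a s ih =>
    obtain ⟨e, rfl⟩ := ih fun b hb => hs b (by simp [hb])
    obtain ⟨i, hi⟩ := Infinite.exists_notMem_finset e.support
    exact ⟨Finsupp.single i a + e,
      expType_add_single (by simpa using hi) (hs a (by simp)).ne'⟩

/-- The ring `Λ_K` of symmetric functions in the variables `x_0, x_1, x_2, …`: formal power series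
of bounded degree that are invariant under all permutations of the variables. -/
noncomputable def Lam (K : Type*) [CommRing K] : Subalgebra K (MvPowerSeries ℕ K) where
  carrier := {f | (∀ σ : Equiv.Perm ℕ, renameEquiv K σ f = f) ∧
    ∃ D : ℕ, ∀ e : ℕ →₀ ℕ, D < e.degree → coeff e f = 0}
  mul_mem' := by
    rintro f g ⟨hf, D, hD⟩ ⟨hg, D', hD'⟩
    refine ⟨fun σ => by rw [map_mul, hf, hg], D + D', fun e he => ?_⟩
    rw [coeff_mul]
    refine Finset.sum_eq_zero fun x hx => ?_
    rw [Finset.HasAntidiagonal.mem_antidiagonal] at hx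
    rw [← hx, map_add] at he
    rcases lt_or_ge D x.1.degree with h | h
    · rw [hD _ h, zero_mul]
    · rw [hD' _ (by omega), mul_zero]
  add_mem' := by
    rintro f g ⟨hf, D, hD⟩ ⟨hg, D', hD'⟩
    refine ⟨fun σ => by rw [map_add, hf, hg], D + D', fun e he => ?_⟩
    rw [map_add, hD _ (by omega), hD' _ (by omega), add_zero]
  algebraMap_mem' := fun r => by
    refine ⟨fun σ => AlgEquiv.commutes _ _, 0, fun e he => ?_⟩
    rw [← c_eq_algebraMap, coeff_C, if_neg]
    rintro rfl
    simp at he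

theorem mem_Lam_iff {K : Type*} [CommRing K] {f : MvPowerSeries ℕ K} : f ∈ Lam K ↔
    (∀ (σ : Equiv.Perm ℕ) (e : ℕ →₀ ℕ), coeff (e.embDomain σ.toEmbedding) f = coeff e f) ∧
    ∃ D : ℕ, ∀ e : ℕ →₀ ℕ, D < e.degree → coeff e f = 0 := by
  have key (σ : Equiv.Perm ℕ) (e : ℕ →₀ ℕ) :
      coeff (e.embDomain σ.toEmbedding) (renameEquiv K σ f) = coeff e f :=
    coeff_embDomain_rename σ.toEmbedding f e
  refine and_congr_left fun _ => ⟨fun h σ e => ?_, fun h σ => ?_⟩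
  · conv_lhs => rw [← h σ]
    exact key σ e
  · ext e
    have he : e = (e.embDomain σ.symm.toEmbedding).embDomain σ.toEmbedding := by
      ext i
      have h1 := Finsupp.embDomain_apply_self σ.toEmbedding (e.embDomain σ.symm.toEmbedding)
        (σ.symm i)
      have h2 := Finsupp.embDomain_apply_self σ.symm.toEmbedding e i
      simp only [Equiv.coe_toEmbedding, Equiv.apply_symm_apply] at h1 h2
      rw [h1, h2]
    conv_lhs => rw [he, key]
    conv_rhs => rw [he, h]

/-- A symmetric function has equal coefficients at monomials with the same exponents. -/
theorem coeff_eq_of_expType_eq {K : Type*} [CommRing K] {f : MvPowerSeries ℕ K} (hf : f ∈ Lam K)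
    {e e' : ℕ →₀ ℕ} (h : expType e = expType e') : coeff e f = coeff e' f := by
  have hfib : ∀ c : ℕ, Nonempty ({i // e i = c} ≃ {i // e' i = c}) := by
    intro c
    rcases Nat.eq_zero_or_pos c with rfl | hc
    · have inf (g : ℕ →₀ ℕ) : Infinite {i // g i = 0} := by
        have : {i | g i = 0} = (g.support : Set ℕ)ᶜ := by ext; simp
        have h2 := (g.support.finite_toSet).infinite_compl
        rw [← this] at h2
        exact h2.to_subtype
      have := inf e
      have := inf e'
      exact nonempty_equiv_of_countable
    · have cnt (g : ℕ →₀ ℕ) : Nat.card {i // g i = c} = (expType g).count c := by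
        rw [expType, Multiset.count_map, ← Finset.filter_val, Finset.card_val,
          ← Nat.card_eq_finsetCard]
        refine Nat.card_congr (Equiv.subtypeEquivRight fun i => ?_)
        simp only [Finset.mem_filter, Finsupp.mem_support_iff]
        omega
      have fin (g : ℕ →₀ ℕ) : Finite {i // g i = c} :=
        Set.Finite.subset g.support.finite_toSet fun i (hi : g i = c) => by
          simp [hi, hc.ne']
      have := fin e
      have := fin e'
      exact (Finite.card_eq).1 (by rw [cnt, cnt, h])
  have F := fun c => (hfib c).some
  let σ : Equiv.Perm ℕ := Equiv.ofFiberEquiv (f := e) (g := e') F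
  have hσ : ∀ i, e' (σ i) = e i := fun i => Equiv.ofFiberEquiv_map F i
  have : e' = e.embDomain σ.toEmbedding := by
    ext i
    obtain ⟨j, rfl⟩ := σ.surjective i
    rw [hσ]
    exact (Finsupp.embDomain_apply_self σ.toEmbedding e j).symm
  rw [this, (mem_Lam_iff.1 hf).1]

/-- The formal power series with given coefficients. -/
def ofCoeff {R : Type*} (c : (ℕ →₀ ℕ) → R) : MvPowerSeries ℕ R := c

theorem coeff_ofCoeff {R : Type*} [Semiring R] (c : (ℕ →₀ ℕ) → R) (e : ℕ →₀ ℕ) :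
    coeff e (ofCoeff c) = c e := rfl

/-- The power sum `p_n = ∑_i x_i ^ n` (for `n ≥ 1`) as a formal power series. -/
noncomputable def psumSeries (R : Type*) [CommSemiring R] (n : ℕ+) : MvPowerSeries ℕ R :=
  open Classical in ofCoeff fun e => if ∃ i, e = Finsupp.single i (n : ℕ) then 1 else 0

theorem coeff_psumSeries (R : Type*) [CommSemiring R] (n : ℕ+) (e : ℕ →₀ ℕ)
    [Decidable (∃ i, e = Finsupp.single i (n : ℕ))] :
    coeff e (psumSeries R n) = if ∃ i, e = Finsupp.single i (n : ℕ) then 1 else 0 := by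
  rw [psumSeries, coeff_ofCoeff]; congr

theorem psumSeries_mem (K : Type*) [CommRing K] (n : ℕ+) : psumSeries K n ∈ Lam K := by
  classical
  refine mem_Lam_iff.2 ⟨fun σ e => ?_, n, fun e he => ?_⟩
  · simp only [coeff_psumSeries]
    congr 1
    refine propext ⟨?_, ?_⟩
    · rintro ⟨i, hi⟩
      refine ⟨σ.symm i, Finsupp.embDomain_injective σ.toEmbedding ?_⟩
      rw [hi, Finsupp.embDomain_single]; simp
    · rintro ⟨i, rfl⟩
      exact ⟨σ i, by rw [Finsupp.embDomain_single]; simp⟩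
  · rw [coeff_psumSeries, if_neg]
    rintro ⟨i, rfl⟩
    simp at he

/-- The power sum symmetric function `p_n`. -/
noncomputable def psum (K : Type*) [CommRing K] (n : ℕ+) : Lam K :=
  ⟨psumSeries K n, psumSeries_mem K n⟩

theorem exists_of_coeff_ne_zero {R : Type*} [CommSemiring R] (s : Multiset ℕ+) (e : ℕ →₀ ℕ)
    (h : coeff e (s.map (psumSeries R)).prod ≠ 0) :
    e.support.card ≤ s.card ∧
      (e.support.card = s.card → expType e = s.map (fun n : ℕ+ => (n : ℕ))) := by
  classical
  induction s using Multiset.induction_on generalizing e with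
  | empty =>
    have : e = 0 := by
      by_contra he
      simp [coeff_one, he] at h
    simp [this, expType]
  | cons a s ih =>
    rw [Multiset.map_cons, Multiset.prod_cons, coeff_mul] at h
    obtain ⟨⟨x, y⟩, hx, hne⟩ := Finset.exists_ne_zero_of_sum_ne_zero h
    rw [Finset.HasAntidiagonal.mem_antidiagonal] at hx
    simp only at hx hne
    rw [coeff_psumSeries] at hne
    obtain ⟨i, rfl⟩ : ∃ i, x = Finsupp.single i (a : ℕ) := by
      by_contra hc
      simp [hc] at hne
    obtain ⟨h1, h2⟩ := ih y (right_ne_zero_of_mul hne)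
    subst hx
    have hle : (Finsupp.single i (a : ℕ) + y).support ⊆ insert i y.support := by
      refine Finsupp.support_add.trans ?_
      rw [Finsupp.support_single _ a.ne_zero]; rfl
    have hc := Finset.card_le_card hle
    by_cases hi : y i = 0
    · have hin : i ∉ y.support := by simpa using hi
      rw [Finset.card_insert_of_notMem hin] at hc
      have e1 : (Finsupp.single i (a : ℕ) + y).support.card = y.support.card + 1 := by
        rw [← card_expType, expType_add_single hi a.ne_zero, Multiset.card_cons, card_expType]
      rw [Multiset.card_cons]
      refine ⟨by omega, fun h => ?_⟩
      rw [expType_add_single hi a.ne_zero, h2 (by omega), Multiset.map_cons]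
    · have hin : i ∈ y.support := by simpa using hi
      rw [Finset.insert_eq_of_mem hin] at hc
      rw [Multiset.card_cons]
      exact ⟨by omega, fun h => by omega⟩

theorem coeff_pos (s : Multiset ℕ+) (e : ℕ →₀ ℕ)
    (h : expType e = s.map (fun n : ℕ+ => (n : ℕ))) :
    0 < coeff e (s.map (psumSeries ℕ)).prod := by
  classical
  induction s using Multiset.induction_on generalizing e with
  | empty =>
    have : e = 0 := by
      simpa [expType] using h
    simp [this]
  | cons a s ih =>
    rw [Multiset.map_cons] at h
    obtain ⟨i, hi, hia⟩ : ∃ i ∈ e.support.val, e i = a := by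
      rw [← Multiset.mem_map]
      change (a : ℕ) ∈ expType e
      simp [h]
    have he : e = Finsupp.single i (a : ℕ) + e.erase i := by
      rw [← hia, Finsupp.single_add_erase]
    have hy : (e.erase i) i = 0 := by simp
    rw [he, expType_add_single hy a.ne_zero] at h
    have := ih (e.erase i) ((Multiset.cons_inj_right _).1 h)
    rw [Multiset.map_cons, Multiset.prod_cons, coeff_mul]
    have hmem : (Finsupp.single i (a : ℕ), e.erase i) ∈
        Finset.HasAntidiagonal.antidiagonal e :=
      Finset.HasAntidiagonal.mem_antidiagonal.2 he.symm
    refine lt_of_lt_of_le ?_ (Finset.single_le_sum (fun _ _ => Nat.zero_le _) hmem)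
    rw [coeff_psumSeries, if_pos ⟨i, rfl⟩, one_mul]
    exact this

theorem coeff_ne_zero {K : Type*} [Field K] [CharZero K] (s : Multiset ℕ+) (e : ℕ →₀ ℕ)
    (h : expType e = s.map (fun n : ℕ+ => (n : ℕ))) :
    coeff e (s.map (psumSeries K)).prod ≠ 0 := by
  classical
  have hm (n : ℕ+) : psumSeries K n = MvPowerSeries.map (Nat.castRingHom K) (psumSeries ℕ n) := by
    ext e
    rw [coeff_map, coeff_psumSeries, coeff_psumSeries]
    split_ifs <;> simp
  have : (s.map (psumSeries K)).prod
      = MvPowerSeries.map (Nat.castRingHom K) (s.map (psumSeries ℕ)).prod := by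
    rw [map_multiset_prod, Multiset.map_map]
    congr 1
    exact Multiset.map_congr rfl fun n _ => hm n
  rw [this, coeff_map]
  simpa using (coeff_pos s e h).ne'

/-- The product `p_λ` of power sums, for the partition `λ` with `d n` parts equal to `n`. -/
theorem aeval_psum_monomial {K : Type*} [Field K] (d : ℕ+ →₀ ℕ) (c : K) :
    ((MvPolynomial.aeval (psum K) (MvPolynomial.monomial d c) : Lam K) : MvPowerSeries ℕ K)
      = c • ((Finsupp.toMultiset d).map (psumSeries K)).prod := by
  rw [MvPolynomial.aeval_monomial, ← Algebra.smul_def, Finsupp.toMultiset_map,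
    Finsupp.prod_toMultiset, Finsupp.prod_mapDomain_index (by simp) (by intros; rw [pow_add])]
  simp [Finsupp.prod, psum]

theorem coeff_aeval_psum {K : Type*} [Field K] (F : MvPolynomial ℕ+ K) (e : ℕ →₀ ℕ) :
    coeff e ((MvPolynomial.aeval (psum K) F : Lam K) : MvPowerSeries ℕ K)
      = ∑ d ∈ F.support, F.coeff d *
          coeff e ((Finsupp.toMultiset d).map (psumSeries K)).prod := by
  conv_lhs => rw [F.as_sum]
  rw [map_sum, AddSubmonoidClass.coe_finsetSum, map_sum]
  exact Finset.sum_congr rfl fun d _ => by rw [aeval_psum_monomial, coeff_smul]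

theorem toMultiset_eq_of_expType {d d' : ℕ+ →₀ ℕ}
    (h : (Finsupp.toMultiset d).map (fun n : ℕ+ => (n : ℕ))
      = (Finsupp.toMultiset d').map (fun n : ℕ+ => (n : ℕ))) : d = d' :=
  (AddEquiv.injective (Multiset.toFinsupp.symm)) (Multiset.map_injective PNat.coe_injective h)

theorem aeval_psum_injective (K : Type*) [Field K] [CharZero K] :
    Function.Injective (MvPolynomial.aeval (psum K) : MvPolynomial ℕ+ K →ₐ[K] Lam K) := by
  rw [injective_iff_map_eq_zero]
  intro F hF
  by_contra hne
  obtain ⟨d, hd, hmax⟩ := Finset.exists_max_image F.support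
    (fun d => (Finsupp.toMultiset d).card) (MvPolynomial.support_nonempty.2 hne)
  obtain ⟨e, he⟩ := exists_expType ((Finsupp.toMultiset d).map (fun n : ℕ+ => (n : ℕ)))
    (by simp)
  have hc : e.support.card = (Finsupp.toMultiset d).card := by
    rw [← card_expType, he, Multiset.card_map]
  have h0 := coeff_aeval_psum F e
  rw [hF, Finset.sum_eq_single d] at h0
  · exact mul_ne_zero (MvPolynomial.mem_support_iff.1 hd) (coeff_ne_zero _ _ he) (by simpa using h0.symm)
  · intro d' hd' hdd
    by_contra hcc
    obtain ⟨h1, h2⟩ := exists_of_coeff_ne_zero _ _ (right_ne_zero_of_mul hcc)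
    have := hmax d' hd'
    have h3 := h2 (by omega)
    rw [he] at h3
    exact hdd (toMultiset_eq_of_expType h3.symm)
  · exact fun h => absurd hd h

theorem aeval_psum_surjective (K : Type*) [Field K] [CharZero K] :
    Function.Surjective (MvPolynomial.aeval (psum K) : MvPolynomial ℕ+ K →ₐ[K] Lam K) := by
  classical
  suffices H : ∀ (k : ℕ) (f : Lam K),
      (∀ e, coeff e (f : MvPowerSeries ℕ K) ≠ 0 → e.support.card < k) →
      f ∈ (MvPolynomial.aeval (psum K) : MvPolynomial ℕ+ K →ₐ[K] Lam K).range by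
    intro f
    obtain ⟨D, hD⟩ := (mem_Lam_iff.1 f.2).2
    refine H (D + 1) f fun e he => ?_
    have h1 : e.degree ≤ D := by
      by_contra h
      exact he (hD e (by omega))
    have h2 : e.support.card ≤ e.degree := by
      rw [Finsupp.degree_apply, Finset.card_eq_sum_ones]
      exact Finset.sum_le_sum fun i hi => Nat.pos_of_ne_zero (Finsupp.mem_support_iff.1 hi)
    omega
  intro k
  induction k with
  | zero =>
    intro f hf
    have : f = 0 := by
      ext e
      by_contra h
      exact absurd (hf e h) (by omega)
    rw [this]
    exact zero_mem _
  | succ k ih =>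
    intro f hf
    obtain ⟨D, hD⟩ := (mem_Lam_iff.1 f.2).2
    choose E hE using fun d : ℕ+ →₀ ℕ =>
      exists_expType ((Finsupp.toMultiset d).map (fun n : ℕ+ => (n : ℕ))) (by simp)
    let T : Set (ℕ+ →₀ ℕ) := {d | (Finsupp.toMultiset d).card = k ∧
      ((Finsupp.toMultiset d).map (fun n : ℕ+ => (n : ℕ))).sum ≤ D}
    have hT : T.Finite := by
      refine Set.Finite.of_injOn (f := fun d => (Finsupp.toMultiset d).map (fun n : ℕ+ => (n : ℕ)))
        (t := ((k • Multiset.range (D + 1)).powerset.toFinset : Finset (Multiset ℕ))) ?_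
        (fun d _ d' _ h => toMultiset_eq_of_expType h) (Finset.finite_toSet _)
      rintro d ⟨h1, h2⟩
      simp only [Finset.mem_coe, Multiset.mem_toFinset, Multiset.mem_powerset]
      refine Multiset.le_iff_count.2 fun a => ?_
      by_cases ha : a ∈ (Finsupp.toMultiset d).map (fun n : ℕ+ => (n : ℕ))
      · have h3 := Multiset.le_sum_of_mem ha
        have h4 : a ∈ Multiset.range (D + 1) := by rw [Multiset.mem_range]; omega
        have h5 := Multiset.count_pos.2 h4
        rw [Multiset.count_nsmul]
        refine (Multiset.count_le_card _ _).trans ?_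
        rw [Multiset.card_map, h1]
        exact Nat.le_mul_of_pos_right _ h5
      · rw [Multiset.count_eq_zero.2 ha]
        exact Nat.zero_le _
    let q (d : ℕ+ →₀ ℕ) : MvPowerSeries ℕ K := ((Finsupp.toMultiset d).map (psumSeries K)).prod
    let F : MvPolynomial ℕ+ K := ∑ d ∈ hT.toFinset,
      MvPolynomial.monomial d (coeff (E d) (f : MvPowerSeries ℕ K) / coeff (E d) (q d))
    have hF : ∀ e, coeff e ((MvPolynomial.aeval (psum K) F : Lam K) : MvPowerSeries ℕ K)
        = ∑ d ∈ hT.toFinset,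
          coeff (E d) (f : MvPowerSeries ℕ K) / coeff (E d) (q d) * coeff e (q d) := by
      intro e
      simp only [F]
      rw [map_sum, AddSubmonoidClass.coe_finsetSum, map_sum]
      exact Finset.sum_congr rfl fun d _ => by rw [aeval_psum_monomial, coeff_smul]
    have hq (d : ℕ+ →₀ ℕ) : q d ∈ Lam K :=
      multiset_prod_mem _ fun x hx => by
        obtain ⟨n, _, rfl⟩ := Multiset.mem_map.1 hx
        exact psumSeries_mem K n
    have hg := ih (f - MvPolynomial.aeval (psum K) F) fun e he => by
      by_contra hk
      apply he
      rw [AddSubgroupClass.coe_sub, map_sub, hF, sub_eq_zero]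
      rcases lt_or_eq_of_le (not_lt.1 hk) with hlt | heq
      · rw [Finset.sum_eq_zero]
        · by_contra h
          exact absurd (hf e h) (by omega)
        · intro d hd
          have hd' : d ∈ T := by simpa using hd
          by_contra h
          have := (exists_of_coeff_ne_zero _ _ (right_ne_zero_of_mul h)).1
          have := hd'.1
          omega
      · obtain ⟨s, hs⟩ : ∃ s : Multiset ℕ+, s.map (fun n : ℕ+ => (n : ℕ)) = expType e := by
          exact CanLift.prf (expType e) fun a ha => expType_pos ha
        obtain ⟨d, rfl⟩ : ∃ d, Finsupp.toMultiset d = s :=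
          ⟨Multiset.toFinsupp s, Multiset.toFinsupp_toMultiset s⟩
        have key : ∀ d' ∈ hT.toFinset, d' ≠ d → coeff e (q d') = 0 := by
          intro d' hd' hne
          have hd'' : d' ∈ T := by simpa using hd'
          by_contra h
          have h2 := (exists_of_coeff_ne_zero _ _ h).2 (by rw [hd''.1, heq])
          rw [← hs] at h2
          exact hne (toMultiset_eq_of_expType h2.symm)
        by_cases hdT : d ∈ T
        · rw [Finset.sum_eq_single d]
          · have h1 : expType e = expType (E d) := by rw [hE, hs]
            rw [coeff_eq_of_expType_eq (hq d) h1, coeff_eq_of_expType_eq f.2 h1,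
              div_mul_cancel₀]
            exact coeff_ne_zero _ _ (hE d)
          · intro d' hd' hne
            rw [key d' hd' hne, mul_zero]
          · intro h
            simp [hdT] at h
        · rw [Finset.sum_eq_zero]
          · apply hD
            by_contra h
            apply hdT
            refine ⟨?_, ?_⟩
            · rw [heq, ← card_expType, ← hs, Multiset.card_map]
            · rw [hs, sum_expType]; omega
          · intro d' hd'
            rw [key d' hd' (by rintro rfl; simp at hd'; exact hdT hd'), mul_zero]
    have := add_mem hg (AlgHom.mem_range_self (MvPolynomial.aeval (psum K)) F)
    rwa [sub_add_cancel] at this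

/-- The isomorphism `K[p_1, p_2, …] ≃ Λ_K` over a field of characteristic zero. -/
noncomputable def psumEquiv (K : Type*) [Field K] [CharZero K] : MvPolynomial ℕ+ K ≃ₐ[K] Lam K :=
  AlgEquiv.ofBijective (MvPolynomial.aeval (psum K))
    ⟨aeval_psum_injective K, aeval_psum_surjective K⟩

theorem psumEquiv_apply (K : Type*) [Field K] [CharZero K] (F : MvPolynomial ℕ+ K) :
    psumEquiv K F = MvPolynomial.aeval (psum K) F := rfl

/-- The basis `(p_λ)` of `Λ_K`. The partition `λ` is given by its multiplicities: the index `d`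
stands for the partition with exactly `d n` parts equal to `n`, so that `p_λ = ∏_n p_n ^ (d n)`. -/
noncomputable def psumBasis (K : Type*) [Field K] [CharZero K] :
    Module.Basis (ℕ+ →₀ ℕ) K (Lam K) :=
  (MvPolynomial.basisMonomials ℕ+ K).map (psumEquiv K).toLinearEquiv

theorem psumBasis_apply (K : Type*) [Field K] [CharZero K] (d : ℕ+ →₀ ℕ) :
    psumBasis K d = d.prod fun n k => psum K n ^ k := by
  simp only [psumBasis, Module.Basis.map_apply, MvPolynomial.coe_basisMonomials,
    AlgEquiv.toLinearEquiv_apply]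
  rw [psumEquiv_apply, MvPolynomial.aeval_monomial, map_one, one_mul]

/-- `z_λ = ∏_n n ^ m_n(λ) * m_n(λ)!`. -/
def zee (d : ℕ+ →₀ ℕ) : ℕ := d.prod fun n k => (n : ℕ) ^ k * k.factorial

/-- The bilinear form on `Λ_K` with `⟨p_λ, p_μ⟩_b = δ_{λ,μ} z_λ b ^ ℓ(λ)`. -/
noncomputable def jackForm {K : Type*} [Field K] [CharZero K] (b : K) :
    LinearMap.BilinForm K (Lam K) :=
  open Classical in
  (psumBasis K).constr K fun d => (psumBasis K).constr K fun d' =>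
    if d = d' then (zee d : K) * b ^ d.degree else 0

theorem jackForm_psumBasis {K : Type*} [Field K] [CharZero K] (b : K) (d d' : ℕ+ →₀ ℕ)
    [Decidable (d = d')] :
    jackForm b (psumBasis K d) (psumBasis K d')
      = if d = d' then (zee d : K) * b ^ d.degree else 0 := by
  simp only [jackForm, Module.Basis.constr_basis]
  congr

/-- The monomial symmetric function `m_μ`: the sum of all monomials whose multiset of nonzero
exponents is the multiset of parts of `μ`. Partitions are represented by Young diagrams, with
`μ.rowLens = [μ_1, μ_2, …, μ_ℓ]`. -/
noncomputable def msymm (K : Type*) [CommRing K] (μ : YoungDiagram) : Lam K :=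
  ⟨ofCoeff fun e => if expType e = (μ.rowLens : Multiset ℕ) then 1 else 0, mem_Lam_iff.2
    ⟨fun σ e => by simp only [coeff_ofCoeff, expType_embDomain],
      (μ.rowLens : Multiset ℕ).sum, fun e he => by
        rw [coeff_ofCoeff, if_neg]
        intro h
        rw [← h, sum_expType] at he
        exact lt_irrefl _ he⟩⟩

/-- The dominance order: `DomLE μ lam` means `μ ≤ lam`, i.e. `|μ| = |lam|` and
`μ_1 + ⋯ + μ_k ≤ lam_1 + ⋯ + lam_k` for all `k`. -/
def DomLE (μ lam : YoungDiagram) : Prop :=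
  μ.card = lam.card ∧
    ∀ k : ℕ, ∑ i ∈ Finset.range k, μ.rowLen i ≤ ∑ i ∈ Finset.range k, lam.rowLen i

/-- `P` is the family `(P_λ^{(b)})_λ` of monic Jack symmetric functions in `Λ_{ℚ(b)}`, where the
indeterminate `b` is `RatFunc.X`: each `P_λ` is `m_λ` plus a linear combination of the `m_μ` with
`μ < λ` in the dominance order, and the `P_λ` are pairwise orthogonal for `⟨ , ⟩_b`. -/
structure IsJackFamily (P : YoungDiagram → Lam (RatFunc ℚ)) : Prop where
  triangular : ∀ lam, P lam - msymm (RatFunc ℚ) lam ∈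
    Submodule.span (RatFunc ℚ) (msymm (RatFunc ℚ) '' {μ | DomLE μ lam ∧ μ ≠ lam})
  orthogonal : ∀ lam μ, lam ≠ μ → jackForm (RatFunc.X : RatFunc ℚ) (P lam) (P μ) = 0

/-- `f ∈ Λ_{ℚ(b)}` can be specialized at the complex number `b₀`: none of its coefficients (with
respect to the monomial symmetric functions) has a pole at `b₀`. -/
def RegularAt (f : Lam (RatFunc ℚ)) (b₀ : ℂ) : Prop :=
  ∀ e : ℕ →₀ ℕ, (coeff e (f : MvPowerSeries ℕ (RatFunc ℚ))).denom.eval₂ (algebraMap ℚ ℂ) b₀ ≠ 0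

/-- The specialization of `f ∈ Λ_{ℚ(b)}` at `b = b₀`, an element of `Λ_ℂ`, obtained by evaluating
every coefficient (meaningful if `RegularAt f b₀`). -/
noncomputable def specialize (f : Lam (RatFunc ℚ)) (b₀ : ℂ) : Lam ℂ :=
  ⟨ofCoeff fun e => (coeff e (f : MvPowerSeries ℕ (RatFunc ℚ))).eval (algebraMap ℚ ℂ) b₀, by
    obtain ⟨h, D, hD⟩ := mem_Lam_iff.1 f.2
    refine mem_Lam_iff.2 ⟨fun σ e => ?_, D, fun e he => ?_⟩
    · rw [coeff_ofCoeff, coeff_ofCoeff, h]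
    · rw [coeff_ofCoeff, hD e he, RatFunc.eval_zero]⟩

end SymFn

namespace Heis

/-- The underlying space of the Fock space `F_α` of the Heisenberg algebra
`[a_m, a_n] = m δ_{m+n,0}`: the polynomial ring in the creation operators `a_{-n}`, `n ≥ 1`
(the variable `X n` is `a_{-n}`), with vacuum vector `|α⟩ = 1`. -/
abbrev Fock : Type := MvPolynomial ℕ+ ℂ

/-- A positive integer as an element of `ℕ+`. -/
def toPNat (n : ℤ) (h : 0 < n) : ℕ+ := ⟨n.toNat, by omega⟩

theorem toPNat_coe (n : ℕ+) (h : 0 < (n : ℤ)) : toPNat n h = n := by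
  apply PNat.coe_injective
  simp [toPNat]

/-- The action of `a_n` on `F_α`: `a_{-n}` (for `n ≥ 1`) is multiplication by `X n`, `a_0` is the
scalar `α`, and `a_n` (for `n ≥ 1`) is `n ∂/∂(X n)`. -/
noncomputable def a (α : ℂ) (n : ℤ) : Module.End ℂ Fock :=
  if h : 0 < n then
    (n : ℂ) • (MvPolynomial.pderiv (toPNat n h)).toLinearMap
  else if h' : n < 0 then
    LinearMap.mulLeft ℂ (MvPolynomial.X (toPNat (-n) (by omega)))
  else α • LinearMap.id

theorem a_pos (α : ℂ) (n : ℕ+) (v : Fock) : a α n v = (n : ℂ) • MvPolynomial.pderiv n v := by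
  have h : 0 < (n : ℤ) := by exact_mod_cast n.pos
  rw [a, dif_pos h, toPNat_coe, LinearMap.smul_apply]
  simp

theorem a_neg (α : ℂ) (n : ℕ+) (v : Fock) : a α (-(n : ℤ)) v = MvPolynomial.X n * v := by
  have h : 0 < (n : ℤ) := by exact_mod_cast n.pos
  rw [a, dif_neg (by omega), dif_pos (by omega)]
  simp only [neg_neg, toPNat_coe, LinearMap.mulLeft_apply]

theorem a_zero (α : ℂ) (v : Fock) : a α 0 v = α • v := by
  simp [a]

/-- The normally ordered product `:a_m a_k:` (the operator of larger index stands to the right). -/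
noncomputable def normalOrdered (α : ℂ) (m k : ℤ) : Module.End ℂ Fock :=
  if m ≤ k then a α m * a α k else a α k * a α m

/-- The bosonized Virasoro generator
`L_n = (1/2) ∑_{m ∈ ℤ} :a_m a_{n-m}: - (n+1) ρ a_n`, as an operator on `F_α`; applied to a vector,
only finitely many terms of the sum are nonzero. -/
noncomputable def vir (α ρ : ℂ) (n : ℤ) (v : Fock) : Fock :=
  (1 / 2 : ℂ) • (∑ᶠ m : ℤ, normalOrdered α m (n - m) v) - (((n : ℂ) + 1) * ρ) • a α n v

/-- Every vector of `F_α` is killed by all `a_n` with `n` large. -/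
theorem exists_a_eq_zero (v : Fock) : ∃ N : ℤ, 0 ≤ N ∧ ∀ (α : ℂ) (n : ℤ), N < n → a α n v = 0 := by
  refine ⟨((v.vars.sup fun n : ℕ+ => (n : ℕ) : ℕ) : ℤ), by positivity, fun α n hn => ?_⟩
  have h0 : 0 < n := lt_of_le_of_lt (by positivity) hn
  have hv : toPNat n h0 ∉ v.vars := by
    intro h
    have h1 := Finset.le_sup (f := fun n : ℕ+ => (n : ℕ)) h
    simp only [toPNat, PNat.mk_coe] at h1
    omega
  have hn' : n = (toPNat n h0 : ℤ) := by
    change n = (n.toNat : ℤ)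
    omega
  rw [hn', a_pos, MvPolynomial.pderiv_eq_zero_of_notMem_vars hv, smul_zero]

theorem normalOrdered_eq_zero {α : ℂ} {v : Fock} {N : ℤ} (hN : ∀ n : ℤ, N < n → a α n v = 0)
    {m k : ℤ} (h : N < m ∨ N < k) : normalOrdered α m k v = 0 := by
  unfold normalOrdered
  split_ifs
  · rw [Module.End.mul_apply, hN k (by omega), map_zero]
  · rw [Module.End.mul_apply, hN m (by omega), map_zero]

/-- The sum defining `L_n v` has finitely many nonzero terms. -/
theorem vir_support_finite (α : ℂ) (n : ℤ) (v : Fock) :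
    (Function.support fun m : ℤ => normalOrdered α m (n - m) v).Finite := by
  obtain ⟨N, -, hN⟩ := exists_a_eq_zero v
  refine (Set.finite_Icc (n - N) N).subset fun m hm => ?_
  by_contra hc
  refine hm (normalOrdered_eq_zero (hN α) ?_)
  rw [Set.mem_Icc] at hc
  omega

theorem exists_vir_eq_zero (v : Fock) :
    ∃ N : ℤ, ∀ (α ρ : ℂ) (n : ℤ), N < n → vir α ρ n v = 0 := by
  obtain ⟨N, h0, hN⟩ := exists_a_eq_zero v
  refine ⟨2 * N, fun α ρ n hn => ?_⟩
  have h (m : ℤ) : normalOrdered α m (n - m) v = 0 :=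
    normalOrdered_eq_zero (hN α) (by omega)
  simp [vir, h, hN α n (by omega)]

theorem finite_of_eq_zero {f : ℕ+ → Fock} {N : ℤ} (h : ∀ n : ℕ+, N < (n : ℤ) → f n = 0) :
    (Function.support f).Finite := by
  refine Set.Finite.subset (Set.Finite.preimage (f := fun n : ℕ+ => (n : ℤ))
    (fun x _ y _ hxy => by simpa using hxy) (Set.finite_Icc 0 N)) fun n hn => ?_
  by_contra hc
  refine hn (h n ?_)
  simp only [Set.mem_preimage, Set.mem_Icc] at hc
  omega

/-- The positive square root of two, as a complex number. -/
noncomputable def sqrtTwo : ℂ := ((Real.sqrt 2 : ℝ) : ℂ)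

/-- The background charge `ρ = (β^{1/2} - β^{-1/2}) / √2`, where `s = β^{1/2}`. -/
noncomputable def rho (s : ℂ) : ℂ := (s - s⁻¹) / sqrtTwo

/-- The operator `Ê_β = √(2β) ∑_{n>0} a_{-n} L_n + ∑_{n>0} a_{-n} a_n (β - 1 - √(2β) a_0)`
on `F_α`, where `β = s ^ 2`, `√(2β) = √2 s` and `L_n` is taken at `ρ = (s - s⁻¹) / √2`; applied to
a vector, only finitely many terms of both sums are nonzero. -/
noncomputable def splitOp (α s : ℂ) (v : Fock) : Fock :=
  (sqrtTwo * s) • (∑ᶠ n : ℕ+, a α (-(n : ℤ)) (vir α (rho s) n v)) +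
    ∑ᶠ n : ℕ+, a α (-(n : ℤ)) (a α n ((s ^ 2 - 1) • v - (sqrtTwo * s) • a α 0 v))

/-- The two sums defining `Ê_β v` have finitely many nonzero terms. -/
theorem splitOp_support_finite (α s : ℂ) (v : Fock) :
    (Function.support fun n : ℕ+ => a α (-(n : ℤ)) (vir α (rho s) n v)).Finite ∧
    (Function.support fun n : ℕ+ =>
      a α (-(n : ℤ)) (a α n ((s ^ 2 - 1) • v - (sqrtTwo * s) • a α 0 v))).Finite := by
  obtain ⟨N, hN⟩ := exists_vir_eq_zero v
  obtain ⟨M, -, hM⟩ := exists_a_eq_zero ((s ^ 2 - 1) • v - (sqrtTwo * s) • a α 0 v)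
  exact ⟨finite_of_eq_zero (N := N) fun n hn => by rw [hN _ _ _ hn, map_zero],
    finite_of_eq_zero (N := M) fun n hn => by rw [hM _ _ hn, map_zero]⟩

/-- The isomorphism `ι_β : F_α → Λ_ℂ`, given by
`a_{-λ} |α⟩ ↦ (√(β/2)) ^ ℓ(λ) p_λ`, where `√(β/2) = s / √2`. -/
noncomputable def iota (s : ℂ) : Fock →ₐ[ℂ] SymFn.Lam ℂ :=
  MvPolynomial.aeval fun n => (s / sqrtTwo) • SymFn.psum ℂ n

theorem sqrtTwo_ne_zero : sqrtTwo ≠ 0 := by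
  simp [sqrtTwo]

theorem iota_bijective {s : ℂ} (hs : s ≠ 0) : Function.Bijective (iota s) := by
  have hc : s / sqrtTwo ≠ 0 := div_ne_zero hs sqrtTwo_ne_zero
  set c := s / sqrtTwo with hcdef
  let F : Fock →ₐ[ℂ] Fock := MvPolynomial.aeval fun n => c • MvPolynomial.X n
  let G : Fock →ₐ[ℂ] Fock := MvPolynomial.aeval fun n => c⁻¹ • MvPolynomial.X n
  have h1 : iota s = (SymFn.psumEquiv ℂ).toAlgHom.comp F := by
    refine MvPolynomial.algHom_ext fun n => ?_
    have : (SymFn.psumEquiv ℂ) (MvPolynomial.X n) = SymFn.psum ℂ n := by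
      rw [SymFn.psumEquiv_apply, MvPolynomial.aeval_X]
    simp [iota, F, this, ← hcdef]
  have hFG : ∀ v, F (G v) = v := fun v => by
    have : F.comp G = AlgHom.id ℂ _ := 
      MvPolynomial.algHom_ext fun n => by simp [F, G, smul_smul, hc]
    exact DFunLike.congr_fun this v
  have hGF : ∀ v, G (F v) = v := fun v => by
    have : G.comp F = AlgHom.id ℂ _ := 
      MvPolynomial.algHom_ext fun n => by simp [F, G, smul_smul, hc]
    exact DFunLike.congr_fun this v
  rw [h1]
  exact (SymFn.psumEquiv ℂ).bijective.comp
    (Function.bijective_iff_has_inverse.2 ⟨G, hGF, hFG⟩)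

/-- The vector `f ∈ F_α` with `ι_β f = P`, where `β = s ^ 2`. -/
noncomputable def iotaInv {s : ℂ} (hs : s ≠ 0) (P : SymFn.Lam ℂ) : Fock :=
  (AlgEquiv.ofBijective (iota s) (iota_bijective hs)).symm P

theorem iota_iotaInv {s : ℂ} (hs : s ≠ 0) (P : SymFn.Lam ℂ) : iota s (iotaInv hs P) = P :=
  (AlgEquiv.ofBijective (iota s) (iota_bijective hs)).apply_symm_apply P

/-- `ε_λ(β) = ∑_i (λ_i ^ 2 + β (1 - 2 i) λ_i)`; the row of index `i` (from `0`) is `λ_{i+1}`. -/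
noncomputable def eps (β : ℂ) (lam : YoungDiagram) : ℂ :=
  ∑ i ∈ Finset.range (lam.colLen 0),
    ((lam.rowLen i : ℂ) ^ 2 + β * (1 - 2 * ((i : ℂ) + 1)) * (lam.rowLen i : ℂ))

end Heis

/-!
Transported to the power sums, `Ê_β` becomes the Laplace–Beltrami operator: both kill constants and
have the same commutator with multiplication by each `p_k`. That operator is self-adjoint for
`⟨ , ⟩_b` when `b = β⁻¹`. In `N` variables it is the Calogero–Sutherland operator, whose divided
differences only turn a monomial into more dominated ones, so it is triangular on the `m_λ` with
diagonal entries `ε_λ(β)`. A self-adjoint operator that is triangular with respect to a basis is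
diagonal on the orthogonal family triangular over that basis, so over `ℚ(b)` the Jack functions are
eigenvectors. Read coefficient by coefficient, the eigenvalue equation is an identity between
rational functions without a pole at `β⁻¹`, and can be specialized.
-/

namespace SymFn

section Triangular

variable {R V ι : Type*} [CommRing R] [AddCommGroup V] [Module R V] {r : ι → ι → Prop}

variable (R r) in
/-- The span of the members of the family `v` whose index is strictly below `i` for `r`. -/
def lowerSpan (v : ι → V) (i : ι) : Submodule R V :=
  Submodule.span R (v '' {j | r j i})

theorem mem_lowerSpan (v : ι → V) {i j : ι} (h : r j i) : v j ∈ lowerSpan R r v i :=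
  Submodule.subset_span ⟨j, h, rfl⟩

theorem lowerSpan_mono [IsTrans ι r] (v : ι → V) {i j : ι} (h : r j i) :
    lowerSpan R r v j ≤ lowerSpan R r v i :=
  Submodule.span_mono (Set.image_mono fun _ hk => trans_of r hk h)

theorem lowerSpan_le_span_range (v : ι → V) (i : ι) :
    lowerSpan R r v i ≤ Submodule.span R (Set.range v) :=
  Submodule.span_mono (Set.image_subset_range _ _)

section Unitriangular

variable {m v : ι → V}

theorem lowerSpan_le_of_sub_mem [IsTrans ι r] [IsWellFounded ι r]
    (hv : ∀ i, v i - m i ∈ lowerSpan R r m i) (i : ι) : lowerSpan R r m i ≤ lowerSpan R r v i := by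
  induction i using IsWellFounded.induction r with
  | ind i ih =>
    refine Submodule.span_le.2 ?_
    rintro _ ⟨j, hj, rfl⟩
    rw [SetLike.mem_coe, ← sub_sub_cancel (v j) (m j)]
    exact sub_mem (mem_lowerSpan v hj) (lowerSpan_mono v hj (ih j hj (hv j)))

theorem span_range_le_of_sub_mem [IsTrans ι r] [IsWellFounded ι r]
    (hv : ∀ i, v i - m i ∈ lowerSpan R r m i) :
    Submodule.span R (Set.range m) ≤ Submodule.span R (Set.range v) := by
  refine Submodule.span_le.2 ?_
  rintro _ ⟨i, rfl⟩
  rw [SetLike.mem_coe, ← sub_sub_cancel (v i) (m i)]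
  exact sub_mem (Submodule.subset_span ⟨i, rfl⟩)
    (lowerSpan_le_span_range v i (lowerSpan_le_of_sub_mem hv i (hv i)))

variable {T : Module.End R V} {c : ι → R}

theorem apply_mem_lowerSpan [IsTrans ι r] (hT : ∀ i, T (m i) - c i • m i ∈ lowerSpan R r m i)
    {i : ι} {x : V} (hx : x ∈ lowerSpan R r m i) : T x ∈ lowerSpan R r m i := by
  refine Submodule.span_le (p := (lowerSpan R r m i).comap T) |>.2 ?_ hx
  rintro _ ⟨j, hj, rfl⟩
  change T (m j) ∈ lowerSpan R r m i
  rw [← sub_add_cancel (T (m j)) (c j • m j)]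
  exact add_mem (lowerSpan_mono m hj (hT j)) (Submodule.smul_mem _ _ (mem_lowerSpan m hj))

theorem apply_sub_smul_mem_lowerSpan [IsTrans ι r]
    (hv : ∀ i, v i - m i ∈ lowerSpan R r m i)
    (hT : ∀ i, T (m i) - c i • m i ∈ lowerSpan R r m i) (i : ι) :
    T (v i) - c i • v i ∈ lowerSpan R r m i := by
  have h : T (v i) - c i • v i =
      T (v i - m i) - c i • (v i - m i) + (T (m i) - c i • m i) := by
    rw [map_sub, smul_sub]; abel
  rw [h]
  exact add_mem (sub_mem (apply_mem_lowerSpan hT (hv i)) (Submodule.smul_mem _ _ (hv i))) (hT i)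

end Unitriangular

theorem apply_eq_zero_of_mem_lowerSpan {B : LinearMap.BilinForm R V} {v : ι → V}
    (hB : B.IsOrthoᵢ v) {i j : ι} (hji : ¬ r j i) {x : V} (hx : x ∈ lowerSpan R r v i) :
    B x (v j) = 0 := by
  refine Submodule.span_le (p := LinearMap.ker (B.flip (v j))) |>.2 ?_ hx
  rintro _ ⟨k, hk, rfl⟩
  exact hB fun hkj => hji (hkj ▸ hk)

/-- For `j` below `i`, the vector `T (v j)` lies in the span of vectors orthogonal to `v i`; for all
other `j`, the vector `T (v i) - c i • v i` lies in the span of vectors orthogonal to `v j`. -/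
theorem apply_eq_smul_of_isSelfAdjoint [IsTrans ι r] [IsWellFounded ι r]
    {B : LinearMap.BilinForm R V} (hB : B.SeparatingLeft) {T : Module.End R V}
    (hBT : B.IsSelfAdjoint T) {m v : ι → V} (hm : Submodule.span R (Set.range m) = ⊤)
    (hv : ∀ i, v i - m i ∈ lowerSpan R r m i) (hBv : B.IsOrthoᵢ v) {c : ι → R}
    (hT : ∀ i, T (m i) - c i • m i ∈ lowerSpan R r m i) (i : ι) : T (v i) = c i • v i := by
  have hmem (j : ι) : T (v j) - c j • v j ∈ lowerSpan R r v j :=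
    lowerSpan_le_of_sub_mem hv j (apply_sub_smul_mem_lowerSpan hv hT j)
  have hBv' : B.flip.IsOrthoᵢ v := fun j k hjk => hBv hjk.symm
  have hortho (j : ι) : B (T (v i) - c i • v i) (v j) = 0 := by
    by_cases hji : r j i
    · have hTj : T (v j) ∈ lowerSpan R r v i := by
        rw [← sub_add_cancel (T (v j)) (c j • v j)]
        exact add_mem (lowerSpan_mono v hji (hmem j))
          (Submodule.smul_mem _ _ (mem_lowerSpan v hji))
      have hBT' : B (v i) (T (v j)) = 0 :=
        apply_eq_zero_of_mem_lowerSpan hBv' (irrefl_of r i) hTj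
      have hBij : B (v i) (v j) = 0 := hBv fun hij => irrefl_of r i (hij ▸ hji)
      rw [map_sub, LinearMap.sub_apply, hBT, hBT', map_smul, LinearMap.smul_apply, hBij, smul_zero,
        sub_zero]
    · exact apply_eq_zero_of_mem_lowerSpan hBv hji (hmem i)
  have hspan : Submodule.span R (Set.range v) = ⊤ :=
    top_le_iff.1 (hm ▸ span_range_le_of_sub_mem hv)
  refine sub_eq_zero.1 (hB _ fun x => ?_)
  have hker : Submodule.span R (Set.range v) ≤ LinearMap.ker (B (T (v i) - c i • v i)) :=
    Submodule.span_le.2 (Set.range_subset_iff.2 hortho)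
  exact hker (hspan ▸ Submodule.mem_top)

end Triangular

section PowerSumOperators

open MvPolynomial

variable {σ K : Type*} [CommRing K]

variable (σ K) in
/-- The gradient `F ↦ (∂_n F)_n`, the universal derivation of a polynomial algebra. Sums over all
`n` of terms linear in `∂_n F` become finite sums over its support. -/
noncomputable def gradient : Derivation K (MvPolynomial σ K) (σ →₀ MvPolynomial σ K) :=
  mkDerivation K fun n => Finsupp.single n 1

theorem gradient_X (n : σ) : gradient σ K (X n) = Finsupp.single n 1 :=
  mkDerivation_X _ _ _

theorem gradient_apply (F : MvPolynomial σ K) (n : σ) : gradient σ K F n = pderiv n F := by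
  classical
  have h : (Finsupp.lapply n).compDer (gradient σ K) = pderiv n :=
    derivation_ext fun k => by
      rw [Derivation.coe_comp, LinearMap.comp_apply, Derivation.coeFn_coe, gradient_X, pderiv_X]
      simp [Finsupp.single_apply, Pi.single_apply, eq_comm]
  exact DFunLike.congr_fun h F

theorem linearCombination_gradient (g : σ → MvPolynomial σ K) (F : MvPolynomial σ K) :
    Finsupp.linearCombination (MvPolynomial σ K) g (gradient σ K F) = mkDerivation K g F := by
  have h : (Finsupp.linearCombination (MvPolynomial σ K) g).compDer (gradient σ K) =
      mkDerivation K g :=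
    derivation_ext fun k => by
      simp [Derivation.coe_comp, gradient_X, mkDerivation_X]
  exact DFunLike.congr_fun h F

theorem mkDerivation_eq_finsum (g : σ → MvPolynomial σ K) (F : MvPolynomial σ K) :
    mkDerivation K g F = ∑ᶠ n, g n * pderiv n F := by
  rw [← linearCombination_gradient, Finsupp.linearCombination_apply, Finsupp.sum,
    ← finsum_eq_sum_of_support_subset]
  · exact finsum_congr fun n => by rw [gradient_apply, smul_eq_mul, mul_comm]
  · intro n hn
    refine Finset.mem_coe.2 (Finsupp.mem_support_iff.2 fun h => hn ?_)
    simp only [h, zero_smul]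

theorem constantCoeff_mkDerivation {g : σ → MvPolynomial σ K}
    (hg : ∀ n, constantCoeff (g n) = 0) (F : MvPolynomial σ K) :
    constantCoeff (mkDerivation K g F) = 0 := by
  rw [← linearCombination_gradient, Finsupp.linearCombination_apply, Finsupp.sum, map_sum]
  exact Finset.sum_eq_zero fun n _ => by rw [smul_eq_mul, map_mul, hg, mul_zero]

variable (K) in
/-- The derivation `∑_i i X_{i+k} ∂_i`. -/
noncomputable def shiftDer (k : ℕ+) : Derivation K (MvPolynomial ℕ+ K) (MvPolynomial ℕ+ K) :=
  mkDerivation K fun i => (i : K) • X (i + k)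

variable (K) in
/-- The map `(F_j)_j ↦ ∑_j j (∑_i i X_{i+j} ∂_i) F_j`. -/
noncomputable def shiftSum : (ℕ+ →₀ MvPolynomial ℕ+ K) →ₗ[K] MvPolynomial ℕ+ K :=
  Finsupp.lsum K fun j => (j : K) • (shiftDer K j : MvPolynomial ℕ+ K →ₗ[K] MvPolynomial ℕ+ K)

theorem shiftSum_single (j : ℕ+) (F : MvPolynomial ℕ+ K) :
    shiftSum K (Finsupp.single j F) = (j : K) • shiftDer K j F := by
  simp [shiftSum]

theorem shiftSum_X_smul (k : ℕ+) (u : ℕ+ →₀ MvPolynomial ℕ+ K) :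
    shiftSum K ((X k : MvPolynomial ℕ+ K) • u) = X k * shiftSum K u +
      (k : K) • Finsupp.linearCombination (MvPolynomial ℕ+ K)
        (fun i : ℕ+ => (i : K) • X (i + k)) u := by
  induction u using Finsupp.induction_linear with
  | zero => simp
  | add u v hu hv => rw [smul_add, map_add, hu, hv, map_add, map_add, mul_add, smul_add]; abel
  | single j G =>
    rw [Finsupp.smul_single, shiftSum_single, shiftSum_single, Finsupp.linearCombination_single,
      smul_eq_mul, smul_eq_mul, Derivation.leibniz, shiftDer, mkDerivation_X, add_comm k]
    simp only [smul_eq_mul, smul_eq_C_mul]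
    ring

variable (K) in
/-- The operator `∑_{i,j} i j X_{i+j} ∂_i ∂_j`. -/
noncomputable def joinOp : Module.End K (MvPolynomial ℕ+ K) :=
  shiftSum K ∘ₗ (gradient ℕ+ K : MvPolynomial ℕ+ K →ₗ[K] _)

theorem joinOp_apply (F : MvPolynomial ℕ+ K) : joinOp K F = shiftSum K (gradient ℕ+ K F) := rfl

theorem joinOp_C (c : K) : joinOp K (C c) = 0 := by
  rw [joinOp_apply, derivation_C, map_zero]

theorem joinOp_X_mul (k : ℕ+) (F : MvPolynomial ℕ+ K) :
    joinOp K (X k * F) = X k * joinOp K F + (2 * (k : K)) • shiftDer K k F := by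
  rw [joinOp_apply, joinOp_apply, Derivation.leibniz, gradient_X, map_add, shiftSum_X_smul,
    linearCombination_gradient, Finsupp.smul_single, smul_eq_mul, mul_one, shiftSum_single,
    two_mul, add_smul, add_assoc]
  rfl

variable (K) in
/-- `∑ X_i X_j` over the pairs of positive integers with `i + j = n`. -/
noncomputable def pairSum (n : ℕ+) : MvPolynomial ℕ+ K := ∑ i ∈ Finset.Iio n, X i * X (n - i)

variable (K) in
/-- The derivation `∑_{i,j} (i + j) X_i X_j ∂_{i+j}`. -/
noncomputable def splitDer : Derivation K (MvPolynomial ℕ+ K) (MvPolynomial ℕ+ K) :=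
  mkDerivation K fun n => (n : K) • pairSum K n

variable (K) in
/-- The derivation `∑_n n ^ 2 X_n ∂_n`. -/
noncomputable def squareDer : Derivation K (MvPolynomial ℕ+ K) (MvPolynomial ℕ+ K) :=
  mkDerivation K fun n => (n : K) ^ 2 • X n

/-- The Laplace–Beltrami (Calogero–Sutherland) operator in the power sums `X n = p_n`:
`∑_{i,j} (i j p_{i+j} ∂_i ∂_j + β (i + j) p_i p_j ∂_{i+j}) + (1 - β) ∑_n n ^ 2 p_n ∂_n`. -/
noncomputable def laplaceBeltrami (β : K) : Module.End K (MvPolynomial ℕ+ K) :=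
  joinOp K + β • (splitDer K : MvPolynomial ℕ+ K →ₗ[K] _) +
    (1 - β) • (squareDer K : MvPolynomial ℕ+ K →ₗ[K] _)

theorem laplaceBeltrami_apply (β : K) (F : MvPolynomial ℕ+ K) :
    laplaceBeltrami β F = joinOp K F + β • splitDer K F + (1 - β) • squareDer K F := rfl

theorem laplaceBeltrami_C (β c : K) : laplaceBeltrami β (C c) = 0 := by
  simp [laplaceBeltrami_apply, joinOp_C]

theorem laplaceBeltrami_X_mul (β : K) (k : ℕ+) (F : MvPolynomial ℕ+ K) :
    laplaceBeltrami β (X k * F) = X k * laplaceBeltrami β F +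
      (β * k) • (pairSum K k * F) + ((1 - β) * (k : K) ^ 2) • (X k * F) +
        (2 * (k : K)) • shiftDer K k F := by
  simp only [laplaceBeltrami_apply, joinOp_X_mul, Derivation.leibniz, splitDer, squareDer,
    mkDerivation_X, smul_eq_mul, smul_eq_C_mul, map_mul]
  ring

variable (K) in
/-- The derivation `∑_i (i + k) X_i ∂_{i+k}`. -/
noncomputable def unshiftDer (k : ℕ+) : Derivation K (MvPolynomial ℕ+ K) (MvPolynomial ℕ+ K) :=
  mkDerivation K fun n => if k < n then (n : K) • X (n - k) else 0

theorem pderiv_apply_derivation (D : Derivation K (MvPolynomial σ K) (MvPolynomial σ K)) (k : σ)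
    (F : MvPolynomial σ K) :
    pderiv k (D F) = D (pderiv k F) + mkDerivation K (fun n => pderiv k (D (X n))) F := by
  classical
  have h : ⁅pderiv k, D⁆ = mkDerivation K fun n => pderiv k (D (X n)) :=
    derivation_ext fun n => by
      rw [Derivation.commutator_apply, mkDerivation_X, pderiv_X, sub_eq_self]
      obtain rfl | hnk := eq_or_ne n k
      · rw [Pi.single_eq_same, Derivation.map_one_eq_zero]
      · rw [Pi.single_eq_of_ne hnk, map_zero]
  rw [← h, Derivation.commutator_apply, add_sub_cancel]

theorem pderiv_unshiftDer (m k : ℕ+) (F : MvPolynomial ℕ+ K) :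
    pderiv m (unshiftDer K k F) = unshiftDer K k (pderiv m F) +
      ((m + k : ℕ+) : K) • pderiv (m + k) F := by
  classical
  have h : mkDerivation K (fun n => pderiv m (unshiftDer K k (X n))) =
      ((m + k : ℕ+) : K) • pderiv (m + k) :=
    derivation_ext fun n => by
      rw [mkDerivation_X, unshiftDer, mkDerivation_X, Derivation.smul_apply]
      obtain rfl | hn := eq_or_ne n (m + k)
      · rw [if_pos (PNat.lt_add_left k m), PNat.add_sub, Derivation.map_smul, pderiv_X_self,
          pderiv_X_self]
      · rw [pderiv_X_of_ne hn, smul_zero]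
        split_ifs with hkn
        · have hnk : n - k ≠ m := fun h => hn (h ▸ (PNat.sub_add_of_lt hkn).symm)
          rw [Derivation.map_smul, pderiv_X_of_ne hnk, smul_zero]
        · exact map_zero _
  rw [pderiv_apply_derivation, h, Derivation.smul_apply]

theorem sum_Iio_sub_comm {M : Type*} [AddCommMonoid M] (n : ℕ+) (f : ℕ+ → ℕ+ → M) :
    ∑ i ∈ Finset.Iio n, f i (n - i) = ∑ i ∈ Finset.Iio n, f (n - i) i := by
  have hlt (i : ℕ+) (hi : i ∈ Finset.Iio n) : n - i ∈ Finset.Iio n := by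
    have h := PNat.lt_add_right (n - i) i
    rwa [PNat.sub_add_of_lt (Finset.mem_Iio.1 hi), ← Finset.mem_Iio] at h
  have hsub (i : ℕ+) (hi : i ∈ Finset.Iio n) : n - (n - i) = i := by
    have h := PNat.add_sub (a := i) (b := n - i)
    rwa [PNat.add_sub_of_lt (Finset.mem_Iio.1 hi)] at h
  exact Finset.sum_nbij' (n - ·) (n - ·) hlt hlt hsub hsub fun i hi => by rw [hsub i hi]

theorem pderiv_pairSum (k n : ℕ+) :
    pderiv k (pairSum K n) = if k < n then 2 * X (n - k) else 0 := by
  classical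
  have h : ∑ i ∈ Finset.Iio n, X (n - i) * pderiv k (X i : MvPolynomial ℕ+ K) =
      if k < n then X (n - k) else 0 := by
    simp [pderiv_X, Pi.single_apply, Finset.sum_ite_eq']
  simp only [pairSum, map_sum, Derivation.leibniz, smul_eq_mul, Finset.sum_add_distrib]
  rw [sum_Iio_sub_comm n fun i j => X i * pderiv k (X j), h]
  split_ifs
  · rw [two_mul]
  · rw [add_zero]

theorem pderiv_splitDer (k : ℕ+) (F : MvPolynomial ℕ+ K) :
    pderiv k (splitDer K F) = splitDer K (pderiv k F) + (2 : K) • unshiftDer K k F := by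
  have h : mkDerivation K (fun n => pderiv k (splitDer K (X n))) = (2 : K) • unshiftDer K k :=
    derivation_ext fun n => by
      rw [mkDerivation_X, splitDer, mkDerivation_X, Derivation.map_smul, pderiv_pairSum,
        Derivation.smul_apply, unshiftDer, mkDerivation_X]
      split_ifs
      · simp only [smul_eq_C_mul, map_ofNat]
        ring
      · simp only [smul_zero]
  rw [pderiv_apply_derivation, h, Derivation.smul_apply]

theorem pderiv_squareDer (k : ℕ+) (F : MvPolynomial ℕ+ K) :
    pderiv k (squareDer K F) = squareDer K (pderiv k F) + (k : K) ^ 2 • pderiv k F := by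
  classical
  have h : mkDerivation K (fun n => pderiv k (squareDer K (X n))) = (k : K) ^ 2 • pderiv k :=
    derivation_ext fun n => by
      rw [mkDerivation_X, squareDer, mkDerivation_X, Derivation.map_smul, pderiv_X,
        Derivation.smul_apply, pderiv_X]
      obtain rfl | hnk := eq_or_ne n k
      · rfl
      · simp only [Pi.single_eq_of_ne hnk, smul_zero]
  rw [pderiv_apply_derivation, h, Derivation.smul_apply]

end PowerSumOperators

section PowerSumForm

open MvPolynomial

theorem zee_add_single (d : ℕ+ →₀ ℕ) (n : ℕ+) :
    zee (d + Finsupp.single n 1) = n * (d n + 1) * zee d := by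
  have hprod (d : ℕ+ →₀ ℕ) : (n : ℕ) ^ d n * (d n).factorial *
      (d.erase n).prod (fun n k => (n : ℕ) ^ k * k.factorial) = zee d :=
    Finsupp.mul_prod_erase' d n (fun n k => (n : ℕ) ^ k * k.factorial) (by simp)
  have herase : (d + Finsupp.single n 1).erase n = d.erase n := by
    rw [Finsupp.erase_add, Finsupp.erase_single, add_zero]
  rw [← hprod, ← hprod d, herase]
  simp only [Finsupp.add_apply, Finsupp.single_eq_same, pow_succ, Nat.factorial_succ]
  ring

theorem zee_pos (d : ℕ+ →₀ ℕ) : 0 < zee d :=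
  Finset.prod_pos fun n _ => Nat.mul_pos (pow_pos n.pos _) (Nat.factorial_pos _)

variable {K : Type*} [Field K] [CharZero K]

theorem jackForm_isSymm (b : K) : (jackForm b).IsSymm := by
  classical
  refine (LinearMap.BilinForm.isSymm_iff_basis (psumBasis K)).2 fun d d' => ?_
  rw [jackForm_psumBasis, jackForm_psumBasis]
  obtain rfl | hd := eq_or_ne d d'
  · rfl
  · rw [if_neg hd, if_neg hd.symm]

theorem jackForm_separatingLeft {b : K} (hb : b ≠ 0) : (jackForm b).SeparatingLeft := by
  classical
  refine LinearMap.IsOrthoᵢ.separatingLeft_of_not_isOrtho_basis_self (psumBasis K)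
    (fun d d' hd => ?_) fun d => ?_
  · exact (jackForm_psumBasis b d d').trans (if_neg hd)
  · rw [jackForm_psumBasis, if_pos rfl]
    exact mul_ne_zero (Nat.cast_ne_zero.2 (zee_pos d).ne') (pow_ne_zero _ hb)

theorem psumEquiv_monomial (d : ℕ+ →₀ ℕ) (c : K) :
    psumEquiv K (monomial d c) = c • psumBasis K d := by
  rw [← mul_one c, ← smul_eq_mul, ← smul_monomial, map_smul]
  simp [psumBasis]

/-- The form `⟨ , ⟩_b` on polynomials in the power sums. -/
noncomputable def powerSumForm (b : K) : LinearMap.BilinForm K (MvPolynomial ℕ+ K) :=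
  (jackForm b).compl₁₂ (psumEquiv K).toLinearMap (psumEquiv K).toLinearMap

theorem powerSumForm_apply (b : K) (F G : MvPolynomial ℕ+ K) :
    powerSumForm b F G = jackForm b (psumEquiv K F) (psumEquiv K G) := rfl

theorem powerSumForm_comm (b : K) (F G : MvPolynomial ℕ+ K) :
    powerSumForm b F G = powerSumForm b G F :=
  (jackForm_isSymm b).eq _ _

open Classical in
theorem powerSumForm_monomial (b : K) (d d' : ℕ+ →₀ ℕ) (c c' : K) :
    powerSumForm b (monomial d c) (monomial d' c') =
      c * c' * if d = d' then (zee d : K) * b ^ d.degree else 0 := by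
  rw [powerSumForm_apply, psumEquiv_monomial, psumEquiv_monomial, map_smul, map_smul,
    LinearMap.smul_apply, jackForm_psumBasis, smul_eq_mul, smul_eq_mul]
  ring

theorem powerSumForm_C (b c : K) (F : MvPolynomial ℕ+ K) :
    powerSumForm b (C c) F = c * constantCoeff F := by
  classical
  induction F using MvPolynomial.induction_on' with
  | add F G hF hG => rw [map_add, hF, hG, map_add, mul_add]
  | monomial d c' =>
    rw [← monomial_zero', powerSumForm_monomial, constantCoeff_monomial]
    obtain rfl | hd := eq_or_ne d 0
    · simp [zee]
    · rw [if_neg hd, if_neg hd.symm, mul_zero, mul_zero]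

theorem powerSumForm_X_mul (b : K) (n : ℕ+) (F G : MvPolynomial ℕ+ K) :
    powerSumForm b (X n * F) G = b * n * powerSumForm b F (pderiv n G) := by
  classical
  induction F using MvPolynomial.induction_on' with
  | add F F' hF hF' => simp only [mul_add, map_add, LinearMap.add_apply, hF, hF']
  | monomial d c =>
    induction G using MvPolynomial.induction_on' with
    | add G G' hG hG' => simp only [mul_add, map_add, hG, hG']
    | monomial d' c' =>
      rw [mul_comm, X, monomial_mul, mul_one, pderiv_monomial, powerSumForm_monomial,
        powerSumForm_monomial]
      by_cases h : d + Finsupp.single n 1 = d'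
      · subst h
        rw [if_pos rfl, if_pos (add_tsub_cancel_right _ _).symm, zee_add_single, map_add,
          Finsupp.degree_single, Finsupp.add_apply, Finsupp.single_eq_same]
        push_cast
        ring
      · rw [if_neg h]
        by_cases h0 : d' n = 0
        · simp [h0]
        · rw [if_neg]
          · simp
          · rintro rfl
            refine h (tsub_add_cancel_of_le ?_)
            exact Finsupp.single_le_iff.2 (Nat.one_le_iff_ne_zero.2 h0)

/-- Since `X k` is adjoint to `b k ∂_k`, it suffices to compare the commutators of `S` with `X k`
and those of `∂_k` with `T`. -/
theorem isAdjointPair_of_commutator {b : K} {S T : Module.End K (MvPolynomial ℕ+ K)}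
    (hS : ∀ c, S (C c) = 0) (hT : ∀ G, constantCoeff (T G) = 0)
    (h : ∀ k F G, powerSumForm b (S (X k * F) - X k * S F) G =
      b * k * powerSumForm b F (pderiv k (T G) - T (pderiv k G))) :
    LinearMap.IsAdjointPair (powerSumForm b) (powerSumForm b) S T := by
  intro F
  induction F using MvPolynomial.induction_on with
  | C a =>
    intro G
    rw [powerSumForm_C, hT, hS, mul_zero, map_zero, LinearMap.zero_apply]
  | add F F' hF hF' =>
    intro G
    rw [map_add, map_add, map_add, LinearMap.add_apply, LinearMap.add_apply, hF, hF']
  | mul_X F k hF =>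
    intro G
    rw [mul_comm, ← sub_add_cancel (S (X k * F)) (X k * S F), map_add, LinearMap.add_apply, h,
      powerSumForm_X_mul, hF, powerSumForm_X_mul, map_sub]
    ring

theorem isAdjointPair_shiftDer (b : K) (m : ℕ+) :
    LinearMap.IsAdjointPair (powerSumForm b) (powerSumForm b)
      (shiftDer K m : Module.End K (MvPolynomial ℕ+ K))
      (unshiftDer K m : Module.End K (MvPolynomial ℕ+ K)) := by
  refine isAdjointPair_of_commutator (derivation_C _)
    (constantCoeff_mkDerivation fun n => ?_) fun k F G => ?_
  · split_ifs
    · simp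
    · exact map_zero _
  · have hS : shiftDer K m (X k * F) - X k * shiftDer K m F = (k : K) • (X (k + m) * F) := by
      rw [Derivation.leibniz, smul_eq_mul, smul_eq_mul, add_sub_cancel_left, shiftDer,
        mkDerivation_X, mul_smul_comm, mul_comm]
    simp only [Derivation.coeFn_coe]
    rw [hS, pderiv_unshiftDer, add_sub_cancel_left, map_smul, map_smul, LinearMap.smul_apply,
      powerSumForm_X_mul]
    simp only [smul_eq_mul]
    ring

theorem isAdjointPair_joinOp {b β : K} (hb : b * β = 1) :
    LinearMap.IsAdjointPair (powerSumForm b) (powerSumForm b) (joinOp K)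
      ⇑(β • (splitDer K : Module.End K (MvPolynomial ℕ+ K))) := by
  refine isAdjointPair_of_commutator joinOp_C (fun G => ?_) fun k F G => ?_
  · have h0 : constantCoeff (splitDer K G) = 0 :=
      constantCoeff_mkDerivation (fun n => by simp [pairSum]) G
    rw [LinearMap.smul_apply, Derivation.coeFn_coe, smul_eq_C_mul, map_mul, h0, mul_zero]
  · have hshift : powerSumForm b (shiftDer K k F) G = powerSumForm b F (unshiftDer K k G) :=
      isAdjointPair_shiftDer b k F G
    rw [joinOp_X_mul, add_sub_cancel_left, LinearMap.smul_apply, LinearMap.smul_apply,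
      Derivation.coeFn_coe, Derivation.map_smul, pderiv_splitDer, smul_add, add_sub_cancel_left,
      map_smul, LinearMap.smul_apply, hshift, smul_smul, map_smul]
    simp only [smul_eq_mul]
    linear_combination (-2 * k * powerSumForm b F (unshiftDer K k G)) * hb

theorem isSelfAdjoint_squareDer (b : K) :
    (powerSumForm b).IsSelfAdjoint (squareDer K : Module.End K (MvPolynomial ℕ+ K)) := by
  refine isAdjointPair_of_commutator (derivation_C _)
    (constantCoeff_mkDerivation fun n => by simp) fun k F G => ?_
  have hS : squareDer K (X k * F) - X k * squareDer K F = (k : K) ^ 2 • (X k * F) := by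
    rw [Derivation.leibniz, smul_eq_mul, smul_eq_mul, add_sub_cancel_left, squareDer,
      mkDerivation_X, mul_smul_comm, mul_comm]
  simp only [Derivation.coeFn_coe]
  rw [hS, pderiv_squareDer, add_sub_cancel_left, map_smul, map_smul, LinearMap.smul_apply,
    powerSumForm_X_mul]
  simp only [smul_eq_mul]
  ring

theorem isSelfAdjoint_laplaceBeltrami {b β : K} (hb : b * β = 1) :
    (powerSumForm b).IsSelfAdjoint (laplaceBeltrami β) := by
  have hjoin := isAdjointPair_joinOp hb
  have hsplit : LinearMap.IsAdjointPair (powerSumForm b) (powerSumForm b)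
      ⇑(β • (splitDer K : Module.End K (MvPolynomial ℕ+ K))) (joinOp K) := fun F G => by
    rw [powerSumForm_comm, ← hjoin, powerSumForm_comm]
  have h := (hjoin.add hsplit).add ((isSelfAdjoint_squareDer b).smul (1 - β))
  rwa [add_comm _ ⇑(joinOp K)] at h

/-- The operator `laplaceBeltrami β`, transported to symmetric functions. -/
noncomputable def lamOp (β : K) : Module.End K (Lam K) :=
  (psumEquiv K).toLinearMap ∘ₗ laplaceBeltrami β ∘ₗ (psumEquiv K).symm.toLinearMap

theorem lamOp_psumEquiv (β : K) (F : MvPolynomial ℕ+ K) :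
    lamOp β (psumEquiv K F) = psumEquiv K (laplaceBeltrami β F) := by
  simp [lamOp]

theorem isSelfAdjoint_lamOp {b β : K} (hb : b * β = 1) :
    (jackForm b).IsSelfAdjoint (lamOp β) := by
  intro f g
  obtain ⟨F, rfl⟩ := (psumEquiv K).surjective f
  obtain ⟨G, rfl⟩ := (psumEquiv K).surjective g
  rw [lamOp_psumEquiv, lamOp_psumEquiv, ← powerSumForm_apply, ← powerSumForm_apply,
    isSelfAdjoint_laplaceBeltrami hb]

end PowerSumForm

section FinitelyManyVariables

open MvPolynomial

/-- `∑ x ^ i y ^ j` over the pairs of positive integers with `i + j = n`. -/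
def posHomog {R : Type*} [CommRing R] (n : ℕ) (x y : R) : R :=
  x * y * ∑ i ∈ Finset.range (n - 1), x ^ i * y ^ (n - 1 - 1 - i)

theorem posHomog_self {R : Type*} [CommRing R] (n : ℕ+) (x : R) :
    posHomog n x x = ((n : R) - 1) * x ^ (n : ℕ) := by
  obtain ⟨m, rfl⟩ : ∃ m : ℕ, n = m.succPNat := ⟨n.natPred, (PNat.succPNat_natPred n).symm⟩
  rw [posHomog, geom_sum₂_self, Nat.succPNat_coe, Nat.succ_sub_one, Nat.cast_succ,
    add_sub_cancel_right]
  cases m with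
  | zero => simp
  | succ m => rw [Nat.add_sub_cancel, Nat.succ_eq_add_one]; ring

theorem posHomog_comm {R : Type*} [CommRing R] (n : ℕ) (x y : R) :
    posHomog n x y = posHomog n y x := by
  rw [posHomog, posHomog, mul_comm x, geom_sum₂_comm]

theorem sub_mul_posHomog {R : Type*} [CommRing R] (n : ℕ) (x y : R) :
    (x - y) * posHomog n x y = x * y * (x ^ (n - 1) - y ^ (n - 1)) := by
  rw [posHomog, mul_left_comm, mul_comm (x - y), geom_sum₂_mul]

theorem sum_Iio_pow_mul_pow {R : Type*} [CommRing R] (n : ℕ+) (x y : R) :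
    ∑ i ∈ Finset.Iio n, x ^ (i : ℕ) * y ^ ((n - i : ℕ+) : ℕ) = posHomog n x y := by
  rw [posHomog, Finset.mul_sum]
  refine Finset.sum_nbij' PNat.natPred Nat.succPNat (fun i hi => ?_) (fun i hi => ?_)
    (fun i _ => PNat.succPNat_natPred i) (fun i _ => Nat.natPred_succPNat i) fun i hi => ?_
  · have hin : (i : ℕ) < n := PNat.coe_lt_coe _ _ |>.2 (Finset.mem_Iio.1 hi)
    rw [Finset.mem_range, PNat.natPred]
    have := i.pos
    omega
  · rw [Finset.mem_range] at hi
    rw [Finset.mem_Iio, ← PNat.coe_lt_coe, Nat.succPNat_coe]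
    omega
  · have hin : i < n := Finset.mem_Iio.1 hi
    obtain ⟨j, rfl⟩ : ∃ j, n = i + j := ⟨n - i, (PNat.add_sub_of_lt hin).symm⟩
    have hi' : (i : ℕ) = i.natPred + 1 := (PNat.natPred_add_one i).symm
    have hj' : (j : ℕ) = j.natPred + 1 := (PNat.natPred_add_one j).symm
    have hsub : ((i + j : ℕ+) : ℕ) - 1 - 1 - i.natPred = j.natPred := by
      rw [PNat.add_coe]
      omega
    rw [hsub, add_comm i j, PNat.add_sub, hi', hj']
    ring

theorem sum_range_sum_range {M : Type*} [AddCommMonoid M] (g : ℕ → ℕ → M)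
    (hg : ∀ k l, g k l = g l k) (N : ℕ) :
    ∑ k ∈ Finset.range N, ∑ l ∈ Finset.range N, g k l =
      ∑ k ∈ Finset.range N, g k k + 2 • ∑ l ∈ Finset.range N, ∑ k ∈ Finset.range l, g k l := by
  induction N with
  | zero => simp
  | succ N ih =>
    simp only [Finset.sum_range_succ, Finset.sum_add_distrib, ih,
      Finset.sum_congr rfl fun k _ => hg N k, smul_add, two_smul]
    abel

variable {K : Type*} [CommRing K]

variable (K) in
/-- The power sum `x_0 ^ n + ⋯ + x_{N-1} ^ n`. -/
noncomputable def finPsum (N n : ℕ) : MvPolynomial ℕ K := ∑ i ∈ Finset.range N, X i ^ n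

variable (K) in
/-- The restriction of a polynomial in the power sums to the variables `x_0, …, x_{N-1}`. -/
noncomputable def finEval (N : ℕ) : MvPolynomial ℕ+ K →ₐ[K] MvPolynomial ℕ K :=
  aeval fun n => finPsum K N n

theorem finEval_X (N : ℕ) (n : ℕ+) : finEval K N (X n) = finPsum K N n := aeval_X _ _

theorem finEval_C (N : ℕ) (c : K) : finEval K N (C c) = C c := algHom_C _ _

theorem pderiv_finPsum {N i : ℕ} (hi : i < N) (n : ℕ) :
    pderiv i (finPsum K N n) = (n : MvPolynomial ℕ K) * X i ^ (n - 1) := by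
  rw [finPsum, map_sum, Finset.sum_eq_single i]
  · rw [pderiv_pow, pderiv_X_self, mul_one]
  · intro j _ hj
    rw [pderiv_pow, pderiv_X_of_ne hj, mul_zero]
  · exact fun h => absurd (Finset.mem_range.2 hi) h

theorem finEval_pairSum (N : ℕ) (n : ℕ+) :
    finEval K N (pairSum K n) = ((n : MvPolynomial ℕ K) - 1) * finPsum K N n +
      2 * ∑ l ∈ Finset.range N, ∑ k ∈ Finset.range l, posHomog n (X k) (X l) := by
  have h : finEval K N (pairSum K n) =
      ∑ k ∈ Finset.range N, ∑ l ∈ Finset.range N, posHomog n (X k) (X l) := by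
    simp only [pairSum, map_sum, map_mul, finEval_X, finPsum, Finset.sum_mul_sum,
      ← sum_Iio_pow_mul_pow]
    rw [Finset.sum_comm]
    exact Finset.sum_congr rfl fun k _ => Finset.sum_comm
  rw [h, sum_range_sum_range _ fun k l => posHomog_comm n _ _]
  simp only [posHomog_self, ← Finset.mul_sum, finPsum, nsmul_eq_mul, Nat.cast_ofNat]

variable (K) in
/-- The Euler operator `x_i ∂_i`. -/
noncomputable def euler (i : ℕ) : Derivation K (MvPolynomial ℕ K) (MvPolynomial ℕ K) :=
  (X i : MvPolynomial ℕ K) • pderiv i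

theorem euler_apply (i : ℕ) (f : MvPolynomial ℕ K) : euler K i f = X i * pderiv i f := rfl

theorem euler_mul (i : ℕ) (f g : MvPolynomial ℕ K) :
    euler K i (f * g) = f * euler K i g + euler K i f * g := by
  rw [Derivation.leibniz, smul_eq_mul, smul_eq_mul, mul_comm g]

theorem euler_finPsum {N i : ℕ} (hi : i < N) (n : ℕ+) :
    euler K i (finPsum K N n) = (n : MvPolynomial ℕ K) * X i ^ (n : ℕ) := by
  rw [euler_apply, pderiv_finPsum hi, mul_left_comm, mul_pow_sub_one n.ne_zero]

theorem euler_X_pow (i : ℕ) (n : ℕ+) :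
    euler K i (X i ^ (n : ℕ)) = (n : MvPolynomial ℕ K) * X i ^ (n : ℕ) := by
  rw [euler_apply, pderiv_pow, pderiv_X_self, mul_one, mul_left_comm, mul_pow_sub_one n.ne_zero]

theorem coeff_euler (i : ℕ) (f : MvPolynomial ℕ K) (e : ℕ →₀ ℕ) :
    coeff e (euler K i f) = e i * coeff e f := by
  classical
  induction f using MvPolynomial.induction_on' with
  | add f g hf hg => rw [map_add, coeff_add, coeff_add, hf, hg, mul_add]
  | monomial d c =>
    rw [euler_apply, X_mul_pderiv_monomial, coeff_smul, coeff_monomial]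
    split_ifs with h
    · rw [h, nsmul_eq_mul]
    · rw [smul_zero, mul_zero]

theorem finEval_shiftDer (N : ℕ) (n : ℕ+) (F : MvPolynomial ℕ+ K) :
    finEval K N (shiftDer K n F) =
      ∑ i ∈ Finset.range N, X i ^ (n : ℕ) * euler K i (finEval K N F) := by
  induction F using MvPolynomial.induction_on with
  | C c => simp [shiftDer]
  | add F G hF hG => simp only [map_add, hF, hG, mul_add, Finset.sum_add_distrib]
  | mul_X F k hF =>
    have hX : finEval K N (shiftDer K n (X k)) =
        ∑ i ∈ Finset.range N, X i ^ (n : ℕ) * euler K i (finPsum K N k) := by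
      rw [shiftDer, mkDerivation_X, map_smul, finEval_X, finPsum, Finset.smul_sum]
      refine Finset.sum_congr rfl fun i hi => ?_
      rw [euler_finPsum (Finset.mem_range.1 hi), smul_eq_C_mul, map_natCast, PNat.add_coe]
      ring
    rw [Derivation.leibniz, smul_eq_mul, smul_eq_mul, map_add, map_mul, map_mul, map_mul, hF,
      finEval_X, hX, Finset.mul_sum, Finset.mul_sum, ← Finset.sum_add_distrib]
    refine Finset.sum_congr rfl fun i _ => ?_
    rw [euler_mul]
    ring

theorem sum_euler_finPsum_mul (N : ℕ) (n : ℕ+) (f : MvPolynomial ℕ K) :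
    ∑ i ∈ Finset.range N, euler K i (finPsum K N n * f) =
      finPsum K N n * ∑ i ∈ Finset.range N, euler K i f +
        (n : MvPolynomial ℕ K) * finPsum K N n * f := by
  have h (i : ℕ) (hi : i ∈ Finset.range N) : euler K i (finPsum K N n * f) =
      finPsum K N n * euler K i f + (n : MvPolynomial ℕ K) * X i ^ (n : ℕ) * f := by
    rw [euler_mul, euler_finPsum (Finset.mem_range.1 hi)]
  rw [Finset.sum_congr rfl h, Finset.sum_add_distrib, ← Finset.mul_sum, ← Finset.sum_mul,
    ← Finset.mul_sum, ← finPsum]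

theorem sum_euler_euler_finPsum_mul (N : ℕ) (n : ℕ+) (f : MvPolynomial ℕ K) :
    ∑ i ∈ Finset.range N, euler K i (euler K i (finPsum K N n * f)) =
      finPsum K N n * ∑ i ∈ Finset.range N, euler K i (euler K i f) +
        (n : MvPolynomial ℕ K) ^ 2 * finPsum K N n * f +
          2 * (n : MvPolynomial ℕ K) * ∑ i ∈ Finset.range N, X i ^ (n : ℕ) * euler K i f := by
  have h (i : ℕ) (hi : i ∈ Finset.range N) : euler K i (euler K i (finPsum K N n * f)) =
      finPsum K N n * euler K i (euler K i f) + (n : MvPolynomial ℕ K) ^ 2 * X i ^ (n : ℕ) * f +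
        2 * (n : MvPolynomial ℕ K) * (X i ^ (n : ℕ) * euler K i f) := by
    rw [euler_mul, euler_finPsum (Finset.mem_range.1 hi), map_add, euler_mul, euler_mul,
      euler_mul, euler_finPsum (Finset.mem_range.1 hi), euler_X_pow, Derivation.map_natCast]
    ring
  rw [Finset.sum_congr rfl h, Finset.sum_add_distrib, Finset.sum_add_distrib, ← Finset.mul_sum,
    ← Finset.sum_mul, ← Finset.mul_sum, ← Finset.mul_sum, ← finPsum]

variable (K) in
/-- The operator `f ↦ x_k x_l (∂_k f - ∂_l f) / (x_k - x_l)` on polynomials `f` in the power sums of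
`x_0, …, x_{N-1}`. -/
noncomputable def divDiff (N k l : ℕ) : MvPolynomial ℕ+ K →ₗ[K] MvPolynomial ℕ K :=
  (Finsupp.lsum K fun n : ℕ+ =>
    LinearMap.mulLeft K ((n : MvPolynomial ℕ K) * posHomog n (X k) (X l)) ∘ₗ
      (finEval K N).toLinearMap) ∘ₗ (gradient ℕ+ K : MvPolynomial ℕ+ K →ₗ[K] _)

theorem divDiff_C (N k l : ℕ) (c : K) : divDiff K N k l (C c) = 0 := by
  simp [divDiff]

theorem divDiff_X_mul (N k l : ℕ) (n : ℕ+) (F : MvPolynomial ℕ+ K) :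
    divDiff K N k l (X n * F) =
      finPsum K N n * divDiff K N k l F +
        (n : MvPolynomial ℕ K) * posHomog n (X k) (X l) * finEval K N F := by
  simp only [divDiff, LinearMap.comp_apply, Derivation.coeFn_coe, Derivation.leibniz, gradient_X,
    map_add, Finsupp.smul_single, smul_eq_mul, mul_one, Finsupp.lsum_single]
  congr 1
  generalize gradient ℕ+ K F = u
  induction u using Finsupp.induction_linear with
  | zero => simp
  | add u v hu hv => rw [smul_add, map_add, hu, hv, map_add, mul_add]
  | single j G =>
    simp only [Finsupp.smul_single, Finsupp.lsum_single, smul_eq_mul, LinearMap.comp_apply,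
      AlgHom.toLinearMap_apply, map_mul, finEval_X, LinearMap.mulLeft_apply]
    ring

theorem sub_mul_divDiff {N k l : ℕ} (hk : k < N) (hl : l < N) (F : MvPolynomial ℕ+ K) :
    (X k - X l) * divDiff K N k l F =
      X l * euler K k (finEval K N F) - X k * euler K l (finEval K N F) := by
  induction F using MvPolynomial.induction_on with
  | C c => simp [divDiff_C]
  | add F G hF hG => simp only [map_add, mul_add, hF, hG]; ring
  | mul_X F n hF =>
    rw [mul_comm F, divDiff_X_mul, mul_add, mul_left_comm, hF, mul_assoc, mul_left_comm,
      ← mul_assoc (X k - X l), sub_mul_posHomog, map_mul, finEval_X, euler_mul, euler_mul,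
      euler_apply k (finPsum K N n), euler_apply l (finPsum K N n), pderiv_finPsum hk,
      pderiv_finPsum hl]
    ring

theorem finEval_laplaceBeltrami (β : K) (N : ℕ) (F : MvPolynomial ℕ+ K) :
    finEval K N (laplaceBeltrami β F) =
      ∑ i ∈ Finset.range N, euler K i (euler K i (finEval K N F)) +
        C β * (2 * ∑ l ∈ Finset.range N, ∑ k ∈ Finset.range l, divDiff K N k l F -
          ∑ i ∈ Finset.range N, euler K i (finEval K N F)) := by
  induction F using MvPolynomial.induction_on with
  | C c =>
    rw [laplaceBeltrami_C]
    simp [divDiff_C]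
  | add F G hF hG =>
    simp only [map_add, hF, hG, Finset.sum_add_distrib]
    ring
  | mul_X F n hF =>
    rw [mul_comm F, laplaceBeltrami_X_mul]
    simp only [map_add, map_mul, finEval_X, finEval_shiftDer, finEval_pairSum, hF,
      finEval_C, divDiff_X_mul, sum_euler_finPsum_mul, sum_euler_euler_finPsum_mul,
      Finset.sum_add_distrib, ← Finset.mul_sum, ← Finset.sum_mul, smul_eq_C_mul, map_sub, map_one,
      map_pow, map_ofNat, map_natCast]
    ring

end FinitelyManyVariables

section Coefficients

open MvPolynomial

/-- The exponent `e` with `r` units moved from the variable `l` to the variable `k`. -/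
noncomputable def raise (e : ℕ →₀ ℕ) (k l r : ℕ) : ℕ →₀ ℕ :=
  e.erase l + Finsupp.single k r + Finsupp.single l (e l - r)

theorem raise_zero (e : ℕ →₀ ℕ) (k l : ℕ) : raise e k l 0 = e := by
  rw [raise, Finsupp.single_zero, add_zero, Nat.sub_zero, Finsupp.erase_add_single]

theorem raise_apply_of_ne (e : ℕ →₀ ℕ) {k l i : ℕ} (r : ℕ) (hik : i ≠ k) (hil : i ≠ l) :
    raise e k l r i = e i := by
  simp [raise, hik, hil, Finsupp.erase_ne]

theorem support_raise_subset {N k l : ℕ} (hk : k < N) (hl : l < N) {e : ℕ →₀ ℕ}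
    (he : e.support ⊆ Finset.range N) (r : ℕ) : (raise e k l r).support ⊆ Finset.range N := by
  intro i hi
  by_contra h
  have hiN : N ≤ i := by simpa using h
  rw [Finsupp.mem_support_iff, raise_apply_of_ne e r (by omega) (by omega)] at hi
  exact h (he (Finsupp.mem_support_iff.2 hi))

/-- The coefficient at `x ^ e` of the image under the Laplace–Beltrami operator, in the variables
`x_0, …, x_{N-1}`, of the function with coefficients `c`. -/
noncomputable def lbCoeff {R : Type*} [CommRing R] (β : R) (N : ℕ) (c : (ℕ →₀ ℕ) → R)
    (e : ℕ →₀ ℕ) : R :=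
  ∑ i ∈ Finset.range N, (e i : R) ^ 2 * c e +
    β * (2 * ∑ l ∈ Finset.range N, ∑ k ∈ Finset.range l, (-(e l : R) * c e +
        ∑ r ∈ Finset.range (e l), ((e k : R) - e l + 2 * (r + 1)) * c (raise e k l (r + 1))) -
      ∑ i ∈ Finset.range N, (e i : R) * c e)

theorem map_lbCoeff {R S : Type*} [CommRing R] [CommRing S] (φ : R →+* S) (β : R) (N : ℕ)
    (c : (ℕ →₀ ℕ) → R) (e : ℕ →₀ ℕ) :
    φ (lbCoeff β N c e) = lbCoeff (φ β) N (fun e => φ (c e)) e := by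
  simp only [lbCoeff, map_add, map_mul, map_sum, map_sub, map_neg, map_pow, map_natCast,
    map_ofNat, map_one]

section DividedDifference

variable {R : Type*} [CommRing R] {k l : ℕ} {f q : MvPolynomial ℕ R}

theorem coeff_eq_zero_of_sub_mul_eq (hkl : k ≠ l)
    (h : (X k - X l) * q = X l * euler R k f - X k * euler R l f) {d : ℕ →₀ ℕ} (hd : d l = 0) :
    coeff d q = 0 := by
  have hl : l ∉ (Finsupp.single k 1 + d).support := by simp [hd, hkl]
  have hcoeff := congrArg (coeff (Finsupp.single k 1 + d)) h
  rwa [sub_mul, coeff_sub, coeff_sub, coeff_X_mul, coeff_X_mul', if_neg hl, coeff_X_mul', if_neg hl,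
    coeff_X_mul, coeff_euler, hd, Nat.cast_zero, zero_mul, sub_zero, sub_zero] at hcoeff

theorem coeff_sub_coeff_of_sub_mul_eq
    (h : (X k - X l) * q = X l * euler R k f - X k * euler R l f) (d : ℕ →₀ ℕ) :
    coeff (Finsupp.single l 1 + d) q - coeff (Finsupp.single k 1 + d) q =
      ((d k : R) + 1) * coeff (Finsupp.single k 1 + d) f -
        ((d l : R) + 1) * coeff (Finsupp.single l 1 + d) f := by
  have hcoeff := congrArg (coeff (Finsupp.single k 1 + (Finsupp.single l 1 + d))) h
  rw [sub_mul, coeff_sub, coeff_sub, coeff_X_mul, coeff_X_mul,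
    add_left_comm (Finsupp.single k 1), coeff_X_mul, coeff_X_mul, coeff_euler,
    coeff_euler] at hcoeff
  simpa [add_comm] using hcoeff

theorem coeff_raise_sub_coeff_raise (hkl : k ≠ l)
    (h : (X k - X l) * q = X l * euler R k f - X k * euler R l f) {e : ℕ →₀ ℕ} {r : ℕ}
    (hr : r < e l) :
    coeff (raise e k l r) q - coeff (raise e k l (r + 1)) q =
      ((e k : R) + r + 1) * coeff (raise e k l (r + 1)) f -
        ((e l : R) - r) * coeff (raise e k l r) f := by
  obtain ⟨s, hs⟩ := Nat.exists_eq_add_of_lt hr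
  set d := e.erase l + Finsupp.single k r + Finsupp.single l s with hd
  have hl : raise e k l r = Finsupp.single l 1 + d := by
    rw [raise, show e l - r = s + 1 by omega, Finsupp.single_add, hd]
    abel
  have hk : raise e k l (r + 1) = Finsupp.single k 1 + d := by
    rw [raise, show e l - (r + 1) = s by omega, Finsupp.single_add, hd]
    abel
  have hdk : d k = e k + r := by simp [hd, hkl, Finsupp.erase_ne]
  have hdl : d l = s := by simp [hd, hkl.symm]
  rw [hl, hk, coeff_sub_coeff_of_sub_mul_eq h, hdk, hdl, hs]
  push_cast
  ring

theorem coeff_of_sub_mul_eq (hkl : k ≠ l)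
    (h : (X k - X l) * q = X l * euler R k f - X k * euler R l f) (e : ℕ →₀ ℕ) :
    coeff e q = -(e l : R) * coeff e f +
      ∑ r ∈ Finset.range (e l), ((e k : R) - e l + 2 * (r + 1)) *
        coeff (raise e k l (r + 1)) f := by
  have hlast : coeff (raise e k l (e l)) q = 0 :=
    coeff_eq_zero_of_sub_mul_eq hkl h (by simp [raise, hkl.symm])
  have htel := Finset.sum_range_sub' (fun r => coeff (raise e k l r) q) (e l)
  rw [raise_zero, hlast, sub_zero, Finset.sum_congr rfl fun r hr =>
    coeff_raise_sub_coeff_raise hkl h (Finset.mem_range.1 hr), Finset.sum_sub_distrib] at htel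
  have hshift : ∑ r ∈ Finset.range (e l), ((e l : R) - r) * coeff (raise e k l r) f =
      ∑ r ∈ Finset.range (e l), ((e l : R) - (r + 1)) * coeff (raise e k l (r + 1)) f +
        e l * coeff e f := by
    have h0 := Finset.sum_range_succ (fun r : ℕ => ((e l : R) - r) * coeff (raise e k l r) f) (e l)
    rw [Finset.sum_range_succ'] at h0
    simpa [raise_zero] using h0.symm
  rw [← htel, hshift, sub_add_eq_sub_sub, ← Finset.sum_sub_distrib, sub_eq_neg_add, ← neg_mul]
  congr 1
  exact Finset.sum_congr rfl fun r _ => by ring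

end DividedDifference

theorem coeff_finPsum {K : Type*} [CommRing K] {N : ℕ} {e : ℕ →₀ ℕ}
    (he : e.support ⊆ Finset.range N) (n : ℕ+) :
    coeff e (finPsum K N n) = MvPowerSeries.coeff e (psum K n : MvPowerSeries ℕ K) := by
  classical
  rw [psum, coeff_psumSeries, finPsum, coeff_sum]
  simp only [X_pow_eq_monomial, coeff_monomial]
  split_ifs with h
  · obtain ⟨i, rfl⟩ := h
    have hi : i ∈ Finset.range N := he (by simp)
    simp [Finsupp.single_left_inj n.ne_zero, Finset.mem_range.1 hi]
  · exact Finset.sum_eq_zero fun i _ => if_neg fun hi => h ⟨i, hi.symm⟩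

variable {K : Type*} [Field K] [CharZero K]

theorem coeff_finEval {N : ℕ} {e : ℕ →₀ ℕ} (he : e.support ⊆ Finset.range N)
    (F : MvPolynomial ℕ+ K) :
    coeff e (finEval K N F) = MvPowerSeries.coeff e (psumEquiv K F : MvPowerSeries ℕ K) := by
  classical
  induction F using MvPolynomial.induction_on generalizing e with
  | C c =>
    rw [finEval_C, psumEquiv_apply, aeval_C, Subalgebra.coe_algebraMap,
      ← MvPowerSeries.c_eq_algebraMap, coeff_C, MvPowerSeries.coeff_C]
    simp only [eq_comm]
  | add F G hF hG => simp only [map_add, coeff_add, Subalgebra.coe_add, hF he, hG he]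
  | mul_X F n hF =>
    rw [map_mul, map_mul, finEval_X, psumEquiv_apply K (X n), aeval_X, Subalgebra.coe_mul,
      coeff_mul, MvPowerSeries.coeff_mul]
    refine Finset.sum_congr rfl fun x hx => ?_
    have hx' := Finset.HasAntidiagonal.mem_antidiagonal.1 hx
    rw [hF ((Finsupp.support_mono (hx' ▸ le_self_add)).trans he),
      coeff_finPsum ((Finsupp.support_mono (hx' ▸ le_add_self)).trans he)]

theorem coeff_lamOp (β : K) (f : Lam K) {N : ℕ} {e : ℕ →₀ ℕ} (he : e.support ⊆ Finset.range N) :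
    MvPowerSeries.coeff e (lamOp β f : MvPowerSeries ℕ K) =
      lbCoeff β N (fun e => MvPowerSeries.coeff e (f : MvPowerSeries ℕ K)) e := by
  obtain ⟨F, rfl⟩ := (psumEquiv K).surjective f
  have hdiv (l : ℕ) (hl : l ∈ Finset.range N) (k : ℕ) (hk : k ∈ Finset.range l) :
      coeff e (divDiff K N k l F) = -(e l : K) * coeff e (finEval K N F) +
        ∑ r ∈ Finset.range (e l), ((e k : K) - e l + 2 * (r + 1)) *
          MvPowerSeries.coeff (raise e k l (r + 1)) (psumEquiv K F : MvPowerSeries ℕ K) := by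
    rw [Finset.mem_range] at hl hk
    rw [coeff_of_sub_mul_eq hk.ne (sub_mul_divDiff (hk.trans hl) hl F)]
    simp only [coeff_finEval (support_raise_subset (hk.trans hl) hl he _)]
  rw [lamOp_psumEquiv, ← coeff_finEval he, finEval_laplaceBeltrami,
    ← map_ofNat (C : K →+* MvPolynomial ℕ K) 2]
  simp only [coeff_add, coeff_C_mul, coeff_sub, coeff_sum, coeff_euler, lbCoeff,
    ← coeff_finEval he]
  rw [Finset.sum_congr rfl fun l hl => Finset.sum_congr rfl (hdiv l hl)]
  simp only [pow_two, mul_assoc]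

end Coefficients

section Dominance

theorem sum_le_sum_range_of_antitone {M : Type*} [AddCommMonoid M] [PartialOrder M]
    [IsOrderedAddMonoid M] {f : ℕ → M} (hf : Antitone f) (s : Finset ℕ) :
    ∑ i ∈ s, f i ≤ ∑ i ∈ Finset.range s.card, f i := by
  set t := Finset.range s.card with ht
  have hcard : (s \ t).card = (t \ s).card := Finset.card_sdiff_comm (by rw [ht, Finset.card_range])
  have hs : ∑ i ∈ s \ t, f i ≤ (s \ t).card • f s.card :=
    Finset.sum_le_card_nsmul _ _ _ fun i hi => hf (by simpa [ht] using (Finset.mem_sdiff.1 hi).2)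
  have ht' : (t \ s).card • f s.card ≤ ∑ i ∈ t \ s, f i :=
    Finset.card_nsmul_le_sum _ _ _ fun i hi =>
      hf (Finset.mem_range.1 (Finset.mem_sdiff.1 hi).1).le
  rw [← Finset.sum_inter_add_sum_sdiff s t, ← Finset.sum_inter_add_sum_sdiff t s,
    Finset.inter_comm]
  exact add_le_add_right (hs.trans (hcard ▸ ht')) _

theorem exists_subset_map_eq_of_le_map {ι M : Type*} {f : ι → M} {s : Multiset M} {t : Finset ι}
    (h : s ≤ t.val.map f) : ∃ u ⊆ t, u.val.map f = s := by
  obtain ⟨⟨L⟩, ht⟩ := t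
  induction s using Quotient.inductionOn with
  | h l =>
    obtain ⟨l', hperm, hsub⟩ := Multiset.coe_le.1 h
    obtain ⟨L', hL', rfl⟩ := List.sublist_map_iff.1 hsub
    exact ⟨⟨L', Multiset.coe_nodup.2 (hL'.nodup (Multiset.coe_nodup.1 ht))⟩,
      fun _ hx => hL'.subset hx, Quotient.sound hperm⟩

/-- The exponent `(μ_1, μ_2, …)`. -/
noncomputable def partExp (μ : YoungDiagram) : ℕ →₀ ℕ :=
  Finsupp.onFinset (Finset.range (μ.colLen 0)) μ.rowLen fun i hi => by
    rw [Finset.mem_range, ← YoungDiagram.mem_iff_lt_colLen, YoungDiagram.mem_iff_lt_rowLen]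
    exact Nat.pos_of_ne_zero hi

theorem partExp_apply (μ : YoungDiagram) (i : ℕ) : partExp μ i = μ.rowLen i := rfl

theorem support_partExp (μ : YoungDiagram) : (partExp μ).support = Finset.range (μ.colLen 0) := by
  ext i
  rw [Finsupp.mem_support_iff, partExp_apply, Finset.mem_range, ← YoungDiagram.mem_iff_lt_colLen,
    YoungDiagram.mem_iff_lt_rowLen, Nat.pos_iff_ne_zero]

theorem expType_partExp (μ : YoungDiagram) : expType (partExp μ) = (μ.rowLens : Multiset ℕ) := by
  rw [expType, support_partExp]
  rfl

theorem degree_partExp (μ : YoungDiagram) : (partExp μ).degree = μ.card := by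
  have hmaps : ∀ c ∈ μ.cells, c.1 ∈ Finset.range (μ.colLen 0) := fun c hc => by
    rw [Finset.mem_range, ← YoungDiagram.mem_iff_lt_colLen]
    exact μ.up_left_mem le_rfl (Nat.zero_le _) ((YoungDiagram.mem_cells _).1 hc)
  rw [YoungDiagram.card, Finset.card_eq_sum_card_fiberwise hmaps, Finsupp.degree_apply,
    support_partExp]
  exact Finset.sum_congr rfl fun i _ => μ.rowLen_eq_card

theorem sum_range_le_of_expType_eq {e : ℕ →₀ ℕ} {lam : YoungDiagram}
    (h : expType e = (lam.rowLens : Multiset ℕ)) (k : ℕ) :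
    ∑ i ∈ Finset.range k, e i ≤ ∑ i ∈ Finset.range k, lam.rowLen i := by
  set s := (Finset.range k).filter (e · ≠ 0)
  have hle : s.val.map e ≤ (partExp lam).support.val.map (partExp lam) := by
    rw [← expType, expType_partExp, ← h, expType]
    exact Multiset.map_le_map (Finset.val_le_iff.2 fun i hi =>
      Finsupp.mem_support_iff.2 (Finset.mem_filter.1 hi).2)
  obtain ⟨u, -, hu⟩ := exists_subset_map_eq_of_le_map hle
  have hcard : u.card ≤ k := by
    have hus : u.card = s.card := by simpa using congrArg Multiset.card hu
    exact hus ▸ (Finset.card_filter_le _ _).trans_eq (Finset.card_range k)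
  calc ∑ i ∈ Finset.range k, e i = ∑ i ∈ s, e i := (Finset.sum_filter_ne_zero _).symm
    _ = ∑ i ∈ u, lam.rowLen i := (congrArg Multiset.sum hu).symm
    _ ≤ ∑ i ∈ Finset.range u.card, lam.rowLen i :=
      sum_le_sum_range_of_antitone (fun i j => lam.rowLen_anti i j) u
    _ ≤ ∑ i ∈ Finset.range k, lam.rowLen i :=
      Finset.sum_le_sum_of_subset (Finset.range_subset_range.2 hcard)

theorem eq_of_rowLens_eq {μ ν : YoungDiagram}
    (h : (μ.rowLens : Multiset ℕ) = (ν.rowLens : Multiset ℕ)) : μ = ν := by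
  have hlist : μ.rowLens = ν.rowLens := (Multiset.coe_eq_coe.1 h).eq_of_pairwise'
    μ.rowLens_sorted.pairwise ν.rowLens_sorted.pairwise
  exact YoungDiagram.equivListRowLens.injective (Subtype.ext hlist)

theorem exists_rowLens_eq_expType (e : ℕ →₀ ℕ) :
    ∃ μ : YoungDiagram, expType e = (μ.rowLens : Multiset ℕ) := by
  have hs : ((expType e).sort (· ≥ ·)).SortedGE := (Multiset.pairwise_sort _ _).sortedGE
  refine ⟨YoungDiagram.ofRowLens _ hs, ?_⟩
  rw [YoungDiagram.rowLens_ofRowLens_eq_self fun x hx => expType_pos ((Multiset.mem_sort _).1 hx),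
    Multiset.sort_eq]

theorem finite_card_le (D : ℕ) : {μ : YoungDiagram | μ.card ≤ D}.Finite := by
  refine Set.Finite.of_injOn (f := YoungDiagram.cells)
    (t := ((Finset.range D ×ˢ Finset.range D).powerset : Finset (Finset (ℕ × ℕ)))) ?_
    (fun μ _ ν _ h => YoungDiagram.ext h) (Finset.finite_toSet _)
  intro μ hμ
  simp only [Finset.mem_coe, Finset.mem_powerset]
  rintro ⟨i, j⟩ hij
  rw [YoungDiagram.mem_cells] at hij
  have hr : μ.rowLen i ≤ μ.card :=
    μ.rowLen_eq_card.trans_le (Finset.card_le_card (Finset.filter_subset _ _))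
  have hc : μ.colLen j ≤ μ.card :=
    μ.colLen_eq_card.trans_le (Finset.card_le_card (Finset.filter_subset _ _))
  rw [Finset.mem_product, Finset.mem_range, Finset.mem_range]
  exact ⟨((YoungDiagram.mem_iff_lt_colLen.1 hij).trans_le hc).trans_le hμ,
    ((YoungDiagram.mem_iff_lt_rowLen.1 hij).trans_le hr).trans_le hμ⟩

theorem DomLE.trans {μ ν lam : YoungDiagram} (h : DomLE μ ν) (h' : DomLE ν lam) : DomLE μ lam :=
  ⟨h.1.trans h'.1, fun k => (h.2 k).trans (h'.2 k)⟩

theorem DomLE.antisymm {μ ν : YoungDiagram} (h : DomLE μ ν) (h' : DomLE ν μ) : μ = ν := by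
  have hs (k : ℕ) := le_antisymm (h.2 k) (h'.2 k)
  have hr (i : ℕ) : μ.rowLen i = ν.rowLen i := by
    have hsucc := hs (i + 1)
    rwa [Finset.sum_range_succ, Finset.sum_range_succ, hs i, Nat.add_left_cancel_iff] at hsucc
  ext ⟨i, j⟩
  rw [YoungDiagram.mem_cells, YoungDiagram.mem_cells, YoungDiagram.mem_iff_lt_rowLen,
    YoungDiagram.mem_iff_lt_rowLen, hr]

/-- The strict dominance order on partitions. -/
def DomLT (μ lam : YoungDiagram) : Prop := DomLE μ lam ∧ μ ≠ lam

instance : IsTrans YoungDiagram DomLT :=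
  ⟨fun _ _ _ h h' => ⟨h.1.trans h'.1, fun he => h'.2 (h'.1.antisymm (he ▸ h.1))⟩⟩

instance : IsWellFounded YoungDiagram DomLT := by
  refine ⟨Subrelation.wf (fun {μ lam} h => ?_)
    (measure fun lam => {ν | DomLE ν lam}.ncard).wf⟩
  have hfin : {ν | DomLE ν lam}.Finite := (finite_card_le lam.card).subset fun _ hν => hν.1.le
  refine Set.ncard_lt_ncard ⟨fun ν hν => hν.trans h.1, fun hsub => ?_⟩ hfin
  exact h.2 (h.1.antisymm (hsub ⟨rfl, fun _ => le_rfl⟩))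

theorem degree_raise {e : ℕ →₀ ℕ} {k l r : ℕ} (hr : r ≤ e l) :
    (raise e k l r).degree = e.degree := by
  conv_rhs => rw [← Finsupp.erase_add_single l e]
  simp only [raise, map_add, Finsupp.degree_single]
  omega

theorem raise_apply_add {e : ℕ →₀ ℕ} {k l r : ℕ} (hkl : k ≠ l) (hr : r ≤ e l) (i : ℕ) :
    raise e k l r i + (if i = l then r else 0) = e i + if i = k then r else 0 := by
  by_cases hil : i = l
  · subst hil
    simp [raise, hkl.symm, hr]
  by_cases hik : i = k
  · subst hik
    simp [raise, hil, Finsupp.erase_ne]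
  · rw [raise_apply_of_ne e r hik hil, if_neg hil, if_neg hik]

theorem sum_range_raise {e : ℕ →₀ ℕ} {k l r : ℕ} (hkl : k ≠ l) (hr : r ≤ e l) (m : ℕ) :
    ∑ i ∈ Finset.range m, raise e k l r i + (if l < m then r else 0) =
      ∑ i ∈ Finset.range m, e i + if k < m then r else 0 := by
  have h := Finset.sum_congr rfl fun i (_ : i ∈ Finset.range m) => raise_apply_add hkl hr i
  simpa [Finset.sum_add_distrib, Finset.sum_ite_eq'] using h

theorem domLT_of_expType_raise {μ lam : YoungDiagram} {k l r : ℕ} (hkl : k < l) (hr0 : 0 < r)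
    (hr : r ≤ μ.rowLen l)
    (h : expType (raise (partExp μ) k l r) = (lam.rowLens : Multiset ℕ)) : DomLT μ lam := by
  have hsum (m : ℕ) := sum_range_raise (e := partExp μ) hkl.ne hr m
  simp only [partExp_apply] at hsum
  have hle := sum_range_le_of_expType_eq h
  refine ⟨⟨?_, fun m => ?_⟩, ?_⟩
  · rw [← degree_partExp, ← degree_partExp lam, ← sum_expType (partExp lam), expType_partExp, ← h,
      sum_expType, degree_raise hr]
  · have hm := hsum m
    have hlem := hle m
    split_ifs at hm <;> omega
  · rintro rfl
    have hk := hsum (k + 1)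
    have hlek := hle (k + 1)
    rw [if_neg (by omega), if_pos (by omega)] at hk
    omega

end Dominance

section MonomialBasis

variable {K : Type*} [CommRing K]

open Classical in
theorem coeff_msymm (μ : YoungDiagram) (e : ℕ →₀ ℕ) :
    MvPowerSeries.coeff e (msymm K μ : MvPowerSeries ℕ K) =
      if expType e = (μ.rowLens : Multiset ℕ) then 1 else 0 := by
  rw [msymm, coeff_ofCoeff]

theorem eq_sum_smul_msymm {f : Lam K} {D : ℕ}
    (hD : ∀ e : ℕ →₀ ℕ, D < e.degree → MvPowerSeries.coeff e (f : MvPowerSeries ℕ K) = 0) :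
    f = ∑ μ ∈ (finite_card_le D).toFinset,
      MvPowerSeries.coeff (partExp μ) (f : MvPowerSeries ℕ K) • msymm K μ := by
  ext e
  obtain ⟨ν, hν⟩ := exists_rowLens_eq_expType e
  have he : MvPowerSeries.coeff e (f : MvPowerSeries ℕ K) =
      MvPowerSeries.coeff (partExp ν) (f : MvPowerSeries ℕ K) :=
    coeff_eq_of_expType_eq f.2 (hν.trans (expType_partExp ν).symm)
  simp only [AddSubmonoidClass.coe_finsetSum, map_sum, Subalgebra.coe_smul,
    MvPowerSeries.coeff_smul, coeff_msymm, hν]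
  rw [Finset.sum_eq_single ν]
  · rw [if_pos rfl, mul_one, he]
  · exact fun μ _ hμ => by rw [if_neg fun h => hμ (eq_of_rowLens_eq h).symm, mul_zero]
  · intro hν'
    rw [hD (partExp ν) (by simpa [degree_partExp] using hν'), zero_mul]

theorem mem_span_msymm {f : Lam K} {S : Set YoungDiagram}
    (h : ∀ μ ∉ S, MvPowerSeries.coeff (partExp μ) (f : MvPowerSeries ℕ K) = 0) :
    f ∈ Submodule.span K (msymm K '' S) := by
  obtain ⟨D, hD⟩ := (mem_Lam_iff.1 f.2).2
  rw [eq_sum_smul_msymm hD]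
  refine Submodule.sum_mem _ fun μ _ => ?_
  by_cases hμ : μ ∈ S
  · exact Submodule.smul_mem _ _ (Submodule.subset_span ⟨μ, hμ, rfl⟩)
  · rw [h μ hμ, zero_smul]
    exact Submodule.zero_mem _

variable (K) in
theorem span_range_msymm : Submodule.span K (Set.range (msymm K)) = ⊤ := by
  rw [← Set.image_univ, Submodule.eq_top_iff']
  exact fun f => mem_span_msymm fun μ hμ => absurd (Set.mem_univ μ) hμ

end MonomialBasis

section Eigenvalue

/-- `∑_i (λ_i ^ 2 + β (1 - 2 i) λ_i)`, where the row of index `i` (from `0`) is `λ_{i+1}`. -/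
noncomputable def eigenvalue {R : Type*} [CommRing R] (β : R) (lam : YoungDiagram) : R :=
  ∑ i ∈ Finset.range (lam.colLen 0),
    ((lam.rowLen i : R) ^ 2 + β * (1 - 2 * ((i : R) + 1)) * (lam.rowLen i : R))

theorem map_eigenvalue {R S : Type*} [CommRing R] [CommRing S] (φ : R →+* S) (β : R)
    (lam : YoungDiagram) : φ (eigenvalue β lam) = eigenvalue (φ β) lam := by
  simp only [eigenvalue, map_add, map_mul, map_sum, map_sub, map_pow, map_natCast, map_ofNat,
    map_one]

theorem lbCoeff_eq_eigenvalue_mul {R : Type*} [CommRing R] (β : R) {c : (ℕ →₀ ℕ) → R}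
    {μ : YoungDiagram}
    (h : ∀ l k r, k < l → r < μ.rowLen l → c (raise (partExp μ) k l (r + 1)) = 0) :
    lbCoeff β (μ.colLen 0) c (partExp μ) = eigenvalue β μ * c (partExp μ) := by
  have hraise (l k : ℕ) (hk : k ∈ Finset.range l) :
      ∑ r ∈ Finset.range (partExp μ l), ((partExp μ k : R) - partExp μ l + 2 * (r + 1)) *
        c (raise (partExp μ) k l (r + 1)) = 0 :=
    Finset.sum_eq_zero fun r hr => by
      rw [h l k r (Finset.mem_range.1 hk) (Finset.mem_range.1 hr), mul_zero]
  have hdiag (l : ℕ) : ∑ k ∈ Finset.range l, (-(partExp μ l : R) * c (partExp μ) +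
      ∑ r ∈ Finset.range (partExp μ l), ((partExp μ k : R) - partExp μ l + 2 * (r + 1)) *
        c (raise (partExp μ) k l (r + 1))) = l * (-(partExp μ l : R) * c (partExp μ)) := by
    rw [Finset.sum_add_distrib, Finset.sum_eq_zero (hraise l), add_zero, Finset.sum_const,
      Finset.card_range, nsmul_eq_mul]
  simp only [lbCoeff, hdiag, eigenvalue, Finset.sum_mul]
  rw [Finset.mul_sum, ← Finset.sum_sub_distrib, Finset.mul_sum, ← Finset.sum_add_distrib]
  refine Finset.sum_congr rfl fun i _ => ?_
  rw [partExp_apply]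
  ring

variable {K : Type*} [Field K] [CharZero K]

theorem lamOp_msymm_sub_mem (β : K) (lam : YoungDiagram) :
    lamOp β (msymm K lam) - eigenvalue β lam • msymm K lam ∈ lowerSpan K DomLT (msymm K) lam := by
  refine mem_span_msymm fun μ hμ => ?_
  have hraise (l k r : ℕ) (hkl : k < l) (hr : r < μ.rowLen l) :
      MvPowerSeries.coeff (raise (partExp μ) k l (r + 1)) (msymm K lam : MvPowerSeries ℕ K) =
        0 := by
    rw [coeff_msymm, if_neg fun h => hμ (domLT_of_expType_raise hkl r.succ_pos hr h)]
  rw [AddSubgroupClass.coe_sub, map_sub, coeff_lamOp β _ (support_partExp μ).subset,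
    lbCoeff_eq_eigenvalue_mul β hraise, Subalgebra.coe_smul, MvPowerSeries.coeff_smul]
  by_cases h : μ = lam
  · rw [h, sub_self]
  · rw [coeff_msymm, expType_partExp, if_neg fun h' => h (eq_of_rowLens_eq h'), mul_zero,
      mul_zero, sub_zero]

theorem IsJackFamily.lamOp_eq {P : YoungDiagram → Lam (RatFunc ℚ)} (hP : IsJackFamily P)
    (lam : YoungDiagram) :
    lamOp (RatFunc.X : RatFunc ℚ)⁻¹ (P lam) = eigenvalue (RatFunc.X : RatFunc ℚ)⁻¹ lam • P lam := by
  have hform := jackForm_separatingLeft (RatFunc.X_ne_zero (K := ℚ))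
  have hadj := isSelfAdjoint_lamOp (mul_inv_cancel₀ (RatFunc.X_ne_zero (K := ℚ)))
  have hspan := span_range_msymm (RatFunc ℚ)
  have htri (μ : YoungDiagram) :
      P μ - msymm _ μ ∈ lowerSpan (RatFunc ℚ) DomLT (msymm (RatFunc ℚ)) μ := hP.triangular μ
  have hortho : (jackForm (RatFunc.X : RatFunc ℚ)).IsOrthoᵢ P := fun _ _ h => hP.orthogonal _ _ h
  have hop := lamOp_msymm_sub_mem (RatFunc.X : RatFunc ℚ)⁻¹
  exact apply_eq_smul_of_isSelfAdjoint hform hadj hspan htri hortho hop lam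

end Eigenvalue

section Specialization

/-- The ring of rational functions over `ℚ` without a pole at `b₀`. -/
noncomputable def regularSubring (b₀ : ℂ) : Subring (RatFunc ℚ) where
  carrier := {x | x.denom.eval₂ (algebraMap ℚ ℂ) b₀ ≠ 0}
  mul_mem' {x y} hx hy h := by
    have hxy := Polynomial.eval₂_eq_zero_of_dvd_of_eval₂_eq_zero _ _
      (RatFunc.denom_mul_dvd x y) h
    exact mul_ne_zero hx hy (Polynomial.eval₂_mul (algebraMap ℚ ℂ) b₀ ▸ hxy)
  add_mem' {x y} hx hy h := by
    have hxy := Polynomial.eval₂_eq_zero_of_dvd_of_eval₂_eq_zero _ _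
      (RatFunc.denom_add_dvd x y) h
    exact mul_ne_zero hx hy (Polynomial.eval₂_mul (algebraMap ℚ ℂ) b₀ ▸ hxy)
  one_mem' := by simp
  zero_mem' := by simp
  neg_mem' {x} hx h := by
    have hneg : -x = RatFunc.C (-1) * x := by rw [map_neg, map_one, neg_one_mul]
    have hx' := Polynomial.eval₂_eq_zero_of_dvd_of_eval₂_eq_zero _ _
      (RatFunc.denom_mul_dvd (RatFunc.C (-1)) x) (hneg ▸ h)
    rw [RatFunc.denom_C, one_mul] at hx'
    exact hx hx'

/-- Evaluation at `b₀`, a ring homomorphism on the rational functions without a pole there. -/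
noncomputable def regularEval (b₀ : ℂ) : regularSubring b₀ →+* ℂ where
  toFun x := (x : RatFunc ℚ).eval (algebraMap ℚ ℂ) b₀
  map_one' := RatFunc.eval_one _ _
  map_zero' := RatFunc.eval_zero _ _
  map_add' x y := RatFunc.eval_add _ _ x.2 y.2
  map_mul' x y := RatFunc.eval_mul _ _ x.2 y.2

theorem inv_X_mem_regularSubring {b₀ : ℂ} (hb : b₀ ≠ 0) :
    (RatFunc.X : RatFunc ℚ)⁻¹ ∈ regularSubring b₀ := fun h => by
  have hX := Polynomial.eval₂_eq_zero_of_dvd_of_eval₂_eq_zero _ _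
    (RatFunc.denom_inv_dvd (RatFunc.X_ne_zero (K := ℚ))) h
  rw [RatFunc.num_X, Polynomial.eval₂_X] at hX
  exact hb hX

theorem regularEval_inv_X {b₀ : ℂ} (hb : b₀ ≠ 0) :
    regularEval b₀ ⟨_, inv_X_mem_regularSubring hb⟩ = b₀⁻¹ := by
  have hX : (RatFunc.X : RatFunc ℚ) ∈ regularSubring b₀ := by
    change Polynomial.eval₂ _ _ _ ≠ 0
    rw [RatFunc.denom_X, Polynomial.eval₂_one]
    exact one_ne_zero
  have hmul := map_mul (regularEval b₀) ⟨_, inv_X_mem_regularSubring hb⟩ ⟨_, hX⟩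
  have hone : (⟨_, inv_X_mem_regularSubring hb⟩ * ⟨_, hX⟩ : regularSubring b₀) = 1 :=
    Subtype.ext (inv_mul_cancel₀ RatFunc.X_ne_zero)
  have hXb : regularEval b₀ ⟨_, hX⟩ = b₀ := RatFunc.eval_X _ _
  rw [hone, map_one, hXb] at hmul
  exact eq_inv_of_mul_eq_one_left hmul.symm

theorem lamOp_eq_smul_iff {K : Type*} [Field K] [CharZero K] {β a : K} {f : Lam K} :
    lamOp β f = a • f ↔ ∀ N (e : ℕ →₀ ℕ), e.support ⊆ Finset.range N →
      lbCoeff β N (fun d => MvPowerSeries.coeff d (f : MvPowerSeries ℕ K)) e =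
        a * MvPowerSeries.coeff e (f : MvPowerSeries ℕ K) := by
  have hsmul (e : ℕ →₀ ℕ) : MvPowerSeries.coeff e ((a • f : Lam K) : MvPowerSeries ℕ K) =
      a * MvPowerSeries.coeff e (f : MvPowerSeries ℕ K) := by
    rw [Subalgebra.coe_smul, MvPowerSeries.coeff_smul]
  constructor
  · intro h N e he
    rw [← coeff_lamOp β f he, h, hsmul]
  · intro h
    ext e
    obtain ⟨N, hN⟩ : ∃ N, e.support ⊆ Finset.range N := Finset.exists_nat_subset_range _
    rw [coeff_lamOp β f hN, hsmul, h N e hN]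

theorem lamOp_specialize {β : ℂ} (hβ : β ≠ 0) {f : Lam (RatFunc ℚ)} (hf : RegularAt f β⁻¹)
    {lam : YoungDiagram} (h : lamOp (RatFunc.X : RatFunc ℚ)⁻¹ f =
      eigenvalue (RatFunc.X : RatFunc ℚ)⁻¹ lam • f) :
    lamOp β (specialize f β⁻¹) = eigenvalue β lam • specialize f β⁻¹ := by
  let ι := (regularSubring β⁻¹).subtype
  let φ := regularEval β⁻¹
  let β' : regularSubring β⁻¹ := ⟨_, inv_X_mem_regularSubring (inv_ne_zero hβ)⟩
  let c (e : ℕ →₀ ℕ) : regularSubring β⁻¹ :=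
    ⟨MvPowerSeries.coeff e (f : MvPowerSeries ℕ (RatFunc ℚ)), hf e⟩
  have hβ' : φ β' = β := (regularEval_inv_X (inv_ne_zero hβ)).trans (inv_inv β)
  refine lamOp_eq_smul_iff.2 fun N e he => ?_
  have hregular : lbCoeff β' N c e = eigenvalue β' lam * c e := by
    apply Subtype.val_injective
    have hι : ι (lbCoeff β' N c e) = ι (eigenvalue β' lam * c e) := by
      rw [map_lbCoeff, map_mul, map_eigenvalue]
      exact lamOp_eq_smul_iff.1 h N e he
    exact hι
  have hφ := congrArg φ hregular
  rw [map_lbCoeff, map_mul, map_eigenvalue, hβ'] at hφ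
  exact hφ

end Specialization

end SymFn

namespace Heis

section Finsum

variable {ι M : Type*} [AddCommMonoid M]

theorem support_ite_eq_subset [DecidableEq ι] (k : ι) (g : ι → M) :
    (Function.support fun n => if n = k then g n else 0) ⊆ {k} :=
  fun _ hn => by_contra fun h => hn (if_neg h)

theorem finite_support_add_ite_eq [DecidableEq ι] {f : ι → M} (hf : (Function.support f).Finite)
    (k : ι) (g : ι → M) : (Function.support fun n => f n + if n = k then g n else 0).Finite :=
  (hf.union ((Set.finite_singleton k).subset (support_ite_eq_subset k g))).subset
    (Function.support_add _ _)

theorem finsum_add_ite_eq [DecidableEq ι] {f : ι → M} (hf : (Function.support f).Finite) (k : ι)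
    (g : ι → M) : ∑ᶠ n, (f n + if n = k then g n else 0) = ∑ᶠ n, f n + g k := by
  rw [finsum_add_distrib hf ((Set.finite_singleton k).subset (support_ite_eq_subset k g)),
    finsum_eq_single _ k fun n hn => if_neg hn, if_pos rfl]

theorem finsum_eq_sum_Iio_add {f : ℕ+ → M}
    (hf : (Function.support f).Finite) (k : ℕ+) :
    ∑ᶠ n, f n = ∑ n ∈ Finset.Iio k, f n + f k + ∑ᶠ n, f (n + k) := by
  have hrange : Set.range (· + k) = Set.Ioi k := Set.ext fun n =>
    ⟨fun ⟨i, hi⟩ => hi ▸ PNat.lt_add_left k i,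
      fun h => ⟨n - k, (add_comm _ _).trans (PNat.add_sub_of_lt h)⟩⟩
  have hIio : ∑ n ∈ Finset.Iio k, f n + f k = ∑ᶠ n ∈ Set.Iic k, f n := by
    rw [← Finset.coe_Iic, finsum_mem_coe_finset, ← Finset.Iio_insert,
      Finset.sum_insert Finset.notMem_Iio_self, add_comm]
  rw [hIio, ← finsum_mem_range (add_left_injective k), hrange, ← finsum_mem_univ,
    ← Set.Iic_union_Ioi (a := k)]
  exact finsum_mem_union' (Set.Iic_disjoint_Ioi le_rfl) (hf.inter_of_right _)
    (hf.inter_of_right _)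

end Finsum

open MvPolynomial

theorem a_X_mul (α : ℂ) (m : ℤ) (k : ℕ+) (v : Fock) :
    a α m (X k * v) = X k * a α m v + if m = k then (k : ℂ) • v else 0 := by
  classical
  have hk : 0 < (k : ℤ) := by exact_mod_cast k.pos
  rcases lt_trichotomy m 0 with h | rfl | h
  · obtain ⟨n, rfl⟩ : ∃ n : ℕ+, m = -(n : ℤ) := ⟨toPNat (-m) (by omega), by simp [toPNat]; omega⟩
    rw [a_neg, a_neg, if_neg (by omega), add_zero, mul_left_comm]
  · rw [a_zero, a_zero, if_neg (by omega), add_zero, mul_smul_comm]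
  · obtain ⟨n, rfl⟩ : ∃ n : ℕ+, m = (n : ℤ) := ⟨toPNat m h, by simp [toPNat]; omega⟩
    rw [a_pos, a_pos, Derivation.leibniz, pderiv_X, smul_add, Pi.single_apply, smul_eq_mul,
      smul_eq_mul, mul_smul_comm]
    simp only [Nat.cast_inj, PNat.coe_inj, eq_comm (a := k)]
    split_ifs with hnk
    · rw [hnk, mul_one]
    · rw [mul_zero, smul_zero]

theorem normalOrdered_X_mul (α : ℂ) (m j : ℤ) (k : ℕ+) (v : Fock) :
    normalOrdered α m j (X k * v) = X k * normalOrdered α m j v +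
      (if m = k then (k : ℂ) • a α j v else 0) + if j = k then (k : ℂ) • a α m v else 0 := by
  unfold normalOrdered
  split_ifs <;>
    simp only [Module.End.mul_apply, a_X_mul, map_add, map_smul, if_true, add_zero,
      *, if_false]

/-- `[L_n, a_{-k}] = k a_{n-k} - (n + 1) ρ k δ_{n,k}`. -/
theorem vir_X_mul (α ρ : ℂ) (n : ℤ) (k : ℕ+) (v : Fock) :
    vir α ρ n (X k * v) = X k * vir α ρ n v + (k : ℂ) • a α (n - k) v -
      if n = k then (((k : ℂ) + 1) * ρ * k) • v else 0 := by
  have hfin := vir_support_finite α n v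
  have hX : (Function.support fun m : ℤ => X k * normalOrdered α m (n - m) v).Finite :=
    hfin.subset (Function.support_mul_subset_right _ _)
  have hsum : ∑ᶠ m : ℤ, normalOrdered α m (n - m) (X k * v) =
      X k * ∑ᶠ m : ℤ, normalOrdered α m (n - m) v + (2 * (k : ℂ)) • a α (n - k) v := by
    have hiff (m : ℤ) : n - m = k ↔ m = n - k := by omega
    simp only [normalOrdered_X_mul, hiff]
    rw [finsum_add_ite_eq (finite_support_add_ite_eq hX _ _), finsum_add_ite_eq hX,
      ← mul_finsum' _ _ hfin, mul_smul, two_smul, add_assoc]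
  rw [vir, vir, hsum, a_X_mul, mul_sub, mul_smul_comm, mul_smul_comm]
  split_ifs with hnk
  · rw [hnk, Int.cast_natCast]
    module
  · module

theorem finite_support_X_mul_a (α : ℂ) (k : ℕ+) (v : Fock) :
    (Function.support fun n : ℕ+ => X n * a α (n - k) v).Finite := by
  obtain ⟨N, -, hN⟩ := exists_a_eq_zero v
  exact finite_of_eq_zero (N := N + k) fun n hn => by rw [hN _ _ (by omega), mul_zero]

theorem finsum_X_mul_a (α : ℂ) (k : ℕ+) (v : Fock) :
    ∑ᶠ n : ℕ+, X n * a α (n - k) v =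
      SymFn.pairSum ℂ k * v + α • (X k * v) + SymFn.shiftDer ℂ k v := by
  rw [finsum_eq_sum_Iio_add (finite_support_X_mul_a α k v) k]
  congr 2
  · rw [SymFn.pairSum, Finset.sum_mul]
    refine Finset.sum_congr rfl fun n hn => ?_
    have hcast : ((k - n : ℕ+) : ℤ) = k - n := by
      rw [PNat.sub_coe, if_pos (Finset.mem_Iio.1 hn),
        Nat.cast_sub (PNat.coe_le_coe _ _ |>.2 (Finset.mem_Iio.1 hn).le)]
    rw [← neg_sub, ← hcast, a_neg, mul_assoc]
  · rw [sub_self, a_zero, mul_smul_comm]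
  · rw [SymFn.shiftDer, SymFn.mkDerivation_eq_finsum]
    refine finsum_congr fun i => ?_
    rw [PNat.add_coe, Nat.cast_add, add_sub_cancel_right, a_pos, smul_mul_assoc, mul_smul_comm]

theorem finsum_a_neg_vir_X_mul (α s : ℂ) (k : ℕ+) (v : Fock) :
    ∑ᶠ n : ℕ+, a α (-(n : ℤ)) (vir α (rho s) n (X k * v)) =
      X k * ∑ᶠ n : ℕ+, a α (-(n : ℤ)) (vir α (rho s) n v) +
        (k : ℂ) • (SymFn.pairSum ℂ k * v + α • (X k * v) + SymFn.shiftDer ℂ k v) -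
          (((k : ℂ) + 1) * rho s * k) • (X k * v) := by
  have hfin := (splitOp_support_finite α s v).1
  have hX : (Function.support fun n : ℕ+ => X k * a α (-(n : ℤ)) (vir α (rho s) n v)).Finite :=
    hfin.subset (Function.support_mul_subset_right _ _)
  have hk : (Function.support fun n : ℕ+ => (k : ℂ) • (X n * a α (n - k) v)).Finite :=
    (finite_support_X_mul_a α k v).subset (Function.support_const_smul_subset (k : ℂ) _)
  have hterm (n : ℕ+) : a α (-(n : ℤ)) (vir α (rho s) n (X k * v)) =
      X k * a α (-(n : ℤ)) (vir α (rho s) n v) + (k : ℂ) • (X n * a α (n - k) v) +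
        if n = k then -((((k : ℂ) + 1) * rho s * k) • (X n * v)) else 0 := by
    simp only [a_neg, vir_X_mul, Nat.cast_inj, PNat.coe_inj, smul_eq_C_mul]
    split_ifs <;> ring
  rw [finsum_congr hterm,
    finsum_add_ite_eq ((hX.union hk).subset (Function.support_add _ _)),
    finsum_add_distrib hX hk, ← mul_finsum' _ _ hfin, ← smul_finsum, finsum_X_mul_a,
    ← sub_eq_add_neg]

theorem finsum_a_neg_a_X_mul (α : ℂ) (k : ℕ+) (v : Fock) :
    ∑ᶠ n : ℕ+, a α (-(n : ℤ)) (a α n (X k * v)) =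
      X k * ∑ᶠ n : ℕ+, a α (-(n : ℤ)) (a α n v) + (k : ℂ) • (X k * v) := by
  have hder (w : Fock) : ∑ᶠ n : ℕ+, a α (-(n : ℤ)) (a α n w) =
      mkDerivation ℂ (fun n : ℕ+ => (n : ℂ) • X n) w := by
    rw [SymFn.mkDerivation_eq_finsum]
    exact finsum_congr fun n => by rw [a_neg, a_pos, mul_smul_comm, smul_mul_assoc]
  rw [hder, hder, Derivation.leibniz, mkDerivation_X, smul_eq_mul, smul_eq_mul, mul_smul_comm,
    mul_comm v]

theorem sqrtTwo_mul_mul_rho {s : ℂ} (hs : s ≠ 0) : sqrtTwo * s * rho s = s ^ 2 - 1 := by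
  have h := sqrtTwo_ne_zero
  rw [rho]
  field_simp

theorem splitOp_X_mul {s : ℂ} (hs : s ≠ 0) (α : ℂ) (k : ℕ+) (v : Fock) :
    splitOp α s (X k * v) = X k * splitOp α s v +
      (sqrtTwo * s * k) • (SymFn.pairSum ℂ k * v) +
      ((1 - s ^ 2) * (k : ℂ) ^ 2) • (X k * v) + (sqrtTwo * s * k) • SymFn.shiftDer ℂ k v := by
  have hcomm : (s ^ 2 - 1) • (X k * v) - (sqrtTwo * s) • a α 0 (X k * v) =
      X k * ((s ^ 2 - 1) • v - (sqrtTwo * s) • a α 0 v) := by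
    rw [a_zero, a_zero, mul_sub, mul_smul_comm, mul_smul_comm, mul_smul_comm]
  rw [splitOp, splitOp, hcomm, finsum_a_neg_vir_X_mul, finsum_a_neg_a_X_mul, a_zero]
  have hrho := sqrtTwo_mul_mul_rho hs
  simp only [mul_add, mul_sub, mul_smul_comm]
  linear_combination (norm := module) (-(k * (k + 1) : ℂ)) • congrArg (· • (X k * v)) hrho

theorem vir_add (α ρ : ℂ) (n : ℤ) (v w : Fock) :
    vir α ρ n (v + w) = vir α ρ n v + vir α ρ n w := by
  simp only [vir, map_add]
  rw [finsum_add_distrib (vir_support_finite α n v) (vir_support_finite α n w)]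
  module

theorem splitOp_add (α s : ℂ) (v w : Fock) :
    splitOp α s (v + w) = splitOp α s v + splitOp α s w := by
  have hlin : (s ^ 2 - 1) • (v + w) - (sqrtTwo * s) • a α 0 (v + w) =
      ((s ^ 2 - 1) • v - (sqrtTwo * s) • a α 0 v) +
      ((s ^ 2 - 1) • w - (sqrtTwo * s) • a α 0 w) := by
    rw [map_add]
    module
  rw [splitOp, hlin]
  simp only [splitOp, vir_add, map_add (a α _)]
  rw [finsum_add_distrib (splitOp_support_finite α s v).1 (splitOp_support_finite α s w).1,
    finsum_add_distrib (splitOp_support_finite α s v).2 (splitOp_support_finite α s w).2]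
  module

theorem a_C (α : ℂ) {n : ℤ} (hn : 0 < n) (c : ℂ) : a α n (C c) = 0 := by
  have hn' : n = (toPNat n hn : ℤ) := (Int.toNat_of_nonneg hn.le).symm
  rw [hn', a_pos, pderiv_C, smul_zero]

theorem vir_C (α ρ : ℂ) {n : ℤ} (hn : 0 < n) (c : ℂ) : vir α ρ n (C c) = 0 := by
  have hterm (m : ℤ) : normalOrdered α m (n - m) (C c) = 0 :=
    normalOrdered_eq_zero (fun _ hm => a_C α hm c) (by omega)
  rw [vir, finsum_eq_zero_of_forall_eq_zero hterm, a_C α hn, smul_zero, smul_zero, sub_zero]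

theorem splitOp_C (α s c : ℂ) : splitOp α s (C c) = 0 := by
  have hpos (n : ℕ+) : 0 < (n : ℤ) := Int.natCast_pos.2 n.pos
  simp only [splitOp, a_zero, map_sub, map_smul, vir_C α _ (hpos _), a_C α (hpos _), map_zero,
    smul_zero, sub_zero, finsum_zero, add_zero]

/-- The rescaling `X n ↦ (s / √2) X n` of the Fock space, through which `ι_β` factors. -/
noncomputable def rescale (s : ℂ) : Fock →ₐ[ℂ] Fock := aeval fun n => (s / sqrtTwo) • X n

theorem rescale_X (s : ℂ) (n : ℕ+) : rescale s (X n) = (s / sqrtTwo) • X n := aeval_X _ _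

theorem rescale_C (s c : ℂ) : rescale s (C c) = C c := aeval_C _ _

theorem psumEquiv_rescale (s : ℂ) (v : Fock) : SymFn.psumEquiv ℂ (rescale s v) = iota s v := by
  have h : (SymFn.psumEquiv ℂ).toAlgHom.comp (rescale s) = iota s :=
    algHom_ext fun n => by
      simp [iota, rescale_X, SymFn.psumEquiv_apply]
  exact DFunLike.congr_fun h v

theorem rescale_pairSum (s : ℂ) (k : ℕ+) :
    rescale s (SymFn.pairSum ℂ k) = (s / sqrtTwo) ^ 2 • SymFn.pairSum ℂ k := by
  simp only [SymFn.pairSum, map_sum, Finset.smul_sum, map_mul, rescale_X, smul_mul_smul_comm,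
    ← pow_two]

theorem rescale_shiftDer (s : ℂ) (k : ℕ+) (v : Fock) :
    rescale s (SymFn.shiftDer ℂ k v) = SymFn.shiftDer ℂ k (rescale s v) := by
  induction v using MvPolynomial.induction_on with
  | C c => rw [rescale_C, derivation_C, map_zero]
  | add v w hv hw => simp only [map_add, hv, hw]
  | mul_X v n hv =>
    simp only [Derivation.leibniz, smul_eq_mul, map_add, map_mul, hv, rescale_X,
      Derivation.map_smul]
    simp only [SymFn.shiftDer, mkDerivation_X, map_smul, rescale_X]
    rw [smul_comm]

theorem rescale_splitOp {s : ℂ} (hs : s ≠ 0) (α : ℂ) (v : Fock) :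
    rescale s (splitOp α s v) = SymFn.laplaceBeltrami (s ^ 2) (rescale s v) := by
  induction v using MvPolynomial.induction_on with
  | C c => rw [splitOp_C, map_zero, rescale_C, SymFn.laplaceBeltrami_C]
  | add v w hv hw => rw [splitOp_add, map_add, map_add, map_add, hv, hw]
  | mul_X v k hv =>
    have hsq : sqrtTwo ^ 2 = 2 := by
      rw [sqrtTwo, ← Complex.ofReal_pow, Real.sq_sqrt zero_le_two, Complex.ofReal_ofNat]
    have hlin : sqrtTwo * s = 2 * (s / sqrtTwo) := by
      rw [← hsq, pow_two, mul_assoc, mul_div_cancel₀ _ sqrtTwo_ne_zero]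
    have hquad : sqrtTwo * s * (s / sqrtTwo) ^ 2 = s ^ 2 * (s / sqrtTwo) := by
      field_simp [sqrtTwo_ne_zero]
    rw [mul_comm, splitOp_X_mul hs]
    simp only [map_add, map_smul, map_mul, hv, rescale_shiftDer, rescale_pairSum, rescale_X,
      smul_mul_assoc, SymFn.laplaceBeltrami_X_mul]
    linear_combination (norm := module)
      (k : ℂ) • congrArg (· • SymFn.shiftDer ℂ k (rescale s v)) hlin +
        (k : ℂ) • congrArg (· • (SymFn.pairSum ℂ k * rescale s v)) hquad

theorem iota_splitOp {s : ℂ} (hs : s ≠ 0) (α : ℂ) (v : Fock) :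
    iota s (splitOp α s v) = SymFn.lamOp (s ^ 2) (iota s v) := by
  rw [← psumEquiv_rescale, ← psumEquiv_rescale, SymFn.lamOp_psumEquiv, rescale_splitOp hs]

end Heis

theorem proposition2p2
    (P : YoungDiagram → SymFn.Lam (RatFunc ℚ)) (hP : SymFn.IsJackFamily P)
    (β s : ℂ) (hs : s ≠ 0) (hsβ : s ^ 2 = β) (α : ℂ)
    (lam : YoungDiagram) (hreg : SymFn.RegularAt (P lam) β⁻¹) :
    Heis.splitOp α s (Heis.iotaInv hs (SymFn.specialize (P lam) β⁻¹))
      = Heis.eps β lam • Heis.iotaInv hs (SymFn.specialize (P lam) β⁻¹) := by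
  refine (Heis.iota_bijective hs).1 ?_
  rw [Heis.iota_splitOp hs, map_smul, Heis.iota_iotaInv, hsβ]
  exact SymFn.lamOp_specialize (hsβ ▸ pow_ne_zero 2 hs) hreg (hP.lamOp_eq lam)
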